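/- Let $G$ be a group, $N\lhd G$ a normal subgroup, $\sigma\colon N\hookrightarrow G$ the inclusion, and let $\nu\colon C\to A$ be a homomorphism of abelian groups, written additively and regarded as an abelian crossed module $(C,A,\nu)$ (with $A$ acting trivially on $C$). Suppose that the inclusion crossed module $(N,G,\sigma)$ acts on $(C,A,\nu)$: the group $G$ acts on $C$ and on $A$ by automorphisms, and there is a map $\xi\colon N\times A\to C$, such that for all $g\in G$, $h,h'\in N$, $a,a'\in A$, $c\in C$ $$\nu({}^gc)={}^g\nu(c),\quad \nu\xi(h,a)={}^ha-a,\quad \xi(h,\nu(c))={}^hc-c,$$ $${}^g\xi(h,a)=\xi(ghg^{-1},{}^ga),\quad \xi(hh',a)={}^h\xi(h',a)+\xi(h,a),\quad \xi(h,a+a')=\xi(h,a)+\xi(h,a').$$ Then $N$ acts trivially on $\operatorname{Ker}\nu$ and on $A/\operatorname{Im}\nu$, so that both are $G/N$-modules. The action induces an action of the simplicial group $G_*=\mathrm{Nerve}_*(N,G,\sigma)$ on the simplicial abelian group $A_*=\mathrm{Nerve}_*(C,A,\nu)$. Let $H_n((N,G,\sigma),(C,A,\nu))$ denote the $n$th homology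 of the total complex of the bicomplex with $B_q(G_p)\otimes_{G_p}A_p$ in position $(p,q)$, where $B_*(\Gamma)$ is the bar resolution of a group $\Gamma$; the differential in the $q$-direction is induced by that of the bar resolution, and the differential in the $p$-direction is the alternating sum of the face maps. Let $H_n(G/N,-)$ denote ordinary group homology, with $H_n=0$ for $n<0$. Then there is a long exact sequence of abelian groups $$\cdots\to H_{n-1}(G/N,\operatorname{Ker}\nu)\to H_n((N,G,\sigma),(C,A,\nu))\to H_n(G/N,A/\operatorname{Im}\nu)\to H_{n-2}(G/N,\operatorname{Ker}\nu)\to\cdots$$ which ends in $$\cdots\to H_0(G/N,\operatorname{Ker}\nu)\to H_1((N,G,\sigma),(C,A,\nu))\to H_1(G/N,A/\operatorname{Im}\nu)\to 0\to H_0((N,G,\sigma),(C,A,\nu))\to H_0(G/N,A/\operatorname{Im}\nu)\to 0.$$ -/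

import Mathlib

open CategoryTheory

universe u

/-- A crossed module `(H, G, μ)`: a homomorphism `μ : H → G` together with an action of `G` on `H`
by automorphisms, satisfying the precrossed module identity and the Peiffer identity. -/
structure CrossedModule (H G : Type u) [Group H] [Group G] where
  μ : H →* G
  act : G →* MulAut H
  precrossed : ∀ (g : G) (h : H), μ (act g h) = g * μ h * g⁻¹
  peiffer : ∀ h h' : H, act (μ h) h' = h * h' * h⁻¹

/-- The inclusion crossed module `(N, G, σ)` of a normal subgroup `N` of `G`: the inclusion
`σ : N → G`, with `G` acting on `N` by conjugation. -/
def CrossedModule.inclusion {G : Type u} [Group G] (N : Subgroup G) [N.Normal] :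
    CrossedModule N G where
  μ := N.subtype
  act := MulAut.conjNormal
  precrossed g h := by simp
  peiffer h h' := by ext; simp

namespace CrossedModule

variable {H G : Type u} [Group H] [Group G]

/-! ### The nerve of a crossed module

The crossed module `(H, G, μ)` is the internal category in groups with group of objects `G` and
group of arrows `H ⋊ G`, where `(h, g)` is an arrow from `g` to `μ h * g` and
`(h', g') ∘ (h, g) = (h' * h, g)` when `μ h * g = g'`. -/

/-- An `n`-simplex of the nerve: a chain `x₀ ← x₁ ← ⋯ ← xₙ` of objects together with all the
composites, the arrow `xⱼ → xᵢ` (for `i ≤ j`) being `(hᵢⱼ, xⱼ)`. Such a chain is determined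
by `(h₀₁, h₁₂, …, hₙ₋₁ₙ, xₙ)`, which are its coordinates in `H ⋊ (⋯ (H ⋊ G) ⋯)`. The face
`dᵢ` omits the object `xᵢ`. -/
@[ext]
structure NerveObj (X : CrossedModule H G) (n : ℕ) where
  obj : Fin (n + 1) → G
  hom : ∀ i j : Fin (n + 1), i ≤ j → H
  hom_comp : ∀ (i j k : Fin (n + 1)) (hij : i ≤ j) (hjk : j ≤ k),
    hom i j hij * hom j k hjk = hom i k (hij.trans hjk)
  obj_eq : ∀ (i j : Fin (n + 1)) (hij : i ≤ j), obj i = X.μ (hom i j hij) * obj j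

namespace NerveObj

variable {X : CrossedModule H G} {n : ℕ}

/-- Multiplication in the nerve: objects multiply in `G` and arrows in `H ⋊ G`. -/
instance : Mul (NerveObj X n) where
  mul x y :=
    { obj := fun i => x.obj i * y.obj i
      hom := fun i j hij => x.hom i j hij * X.act (x.obj j) (y.hom i j hij)
      hom_comp := fun i j k hij hjk => by
        rw [x.obj_eq j k hjk, ← x.hom_comp i j k hij hjk, ← y.hom_comp i j k hij hjk, map_mul,
          map_mul, MulAut.mul_apply, X.peiffer]
        group
      obj_eq := fun i j hij => by
        rw [map_mul, X.precrossed, x.obj_eq i j hij, y.obj_eq i j hij]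
        group }

instance : One (NerveObj X n) where
  one :=
    { obj := fun _ => 1
      hom := fun _ _ _ => 1
      hom_comp := fun _ _ _ _ _ => by simp
      obj_eq := fun _ _ _ => by simp }

instance : Inv (NerveObj X n) where
  inv x :=
    { obj := fun i => (x.obj i)⁻¹
      hom := fun i j hij => X.act (x.obj j)⁻¹ (x.hom i j hij)⁻¹
      hom_comp := fun i j k hij hjk => by
        rw [x.obj_eq j k hjk, ← x.hom_comp i j k hij hjk, mul_inv_rev, map_mul, ← map_inv,
          MulAut.mul_apply, X.peiffer, ← map_mul]
        congr 1
        group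
      obj_eq := fun i j hij => by
        rw [X.precrossed, x.obj_eq i j hij, map_inv]
        group }

@[simp] lemma mul_obj (x y : NerveObj X n) (i) : (x * y).obj i = x.obj i * y.obj i := rfl

@[simp] lemma mul_hom (x y : NerveObj X n) (i j hij) :
    (x * y).hom i j hij = x.hom i j hij * X.act (x.obj j) (y.hom i j hij) := rfl

@[simp] lemma one_obj (i) : (1 : NerveObj X n).obj i = 1 := rfl

@[simp] lemma one_hom (i j hij) : (1 : NerveObj X n).hom i j hij = 1 := rfl

@[simp] lemma inv_obj (x : NerveObj X n) (i) : (x⁻¹).obj i = (x.obj i)⁻¹ := rfl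

@[simp] lemma inv_hom (x : NerveObj X n) (i j hij) :
    (x⁻¹).hom i j hij = X.act (x.obj j)⁻¹ (x.hom i j hij)⁻¹ := rfl

instance : Group (NerveObj X n) :=
  Group.ofLeftAxioms
    (fun x y z => by
      ext <;> simp [mul_assoc])
    (fun x => by ext <;> simp)
    (fun x => by
      ext
      · simp
      · rw [mul_hom, inv_hom, inv_obj, ← map_mul]
        simp)

/-- The simplicial operator attached to a monotone map `f : [m] → [n]`. -/
def map {m n : ℕ} (f : Fin (m + 1) →o Fin (n + 1)) : NerveObj X n →* NerveObj X m where
  toFun x :=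
    { obj := fun i => x.obj (f i)
      hom := fun i j hij => x.hom (f i) (f j) (f.monotone hij)
      hom_comp := fun _ _ _ _ _ => x.hom_comp _ _ _ _ _
      obj_eq := fun _ _ _ => x.obj_eq _ _ _ }
  map_one' := rfl
  map_mul' _ _ := rfl

end NerveObj

/-- The nerve of a crossed module, a simplicial group. -/
def nerve (X : CrossedModule H G) : SimplicialObject GrpCat.{u} where
  obj n := GrpCat.of (NerveObj X n.unop.len)
  map f := GrpCat.ofHom (NerveObj.map f.unop.toOrderHom)
  map_id _ := rfl
  map_comp _ _ := rfl

/-! ### The nerve of an abelian crossed module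

An abelian crossed module `(C, A, ν)` consists of abelian groups `C`, `A` (written additively), a
homomorphism `ν : C → A`, and the trivial action of `A` on `C`, for which the crossed module
identities hold automatically. So it is given by `ν : C →+ A`. -/

variable {C A : Type u} [AddCommGroup C] [AddCommGroup A]

/-- The `n`-simplices of the nerve of an abelian crossed module: families `(aᵢ)` and
`(cᵢⱼ)_{i ≤ j}` with `cᵢⱼ + cⱼₖ = cᵢₖ` and `aᵢ = ν cᵢⱼ + aⱼ`, as for a general
crossed module. -/
@[ext]
structure AbNerveObj (ν : C →+ A) (n : ℕ) where
  obj : Fin (n + 1) → A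
  hom : ∀ i j : Fin (n + 1), i ≤ j → C
  hom_comp : ∀ (i j k : Fin (n + 1)) (hij : i ≤ j) (hjk : j ≤ k),
    hom i j hij + hom j k hjk = hom i k (hij.trans hjk)
  obj_eq : ∀ (i j : Fin (n + 1)) (hij : i ≤ j), obj i = ν (hom i j hij) + obj j

namespace AbNerveObj

variable {ν : C →+ A} {n : ℕ}

/-- The addition is componentwise because `A` acts trivially on `C`. -/
instance : Add (AbNerveObj ν n) where
  add x y :=
    { obj := fun i => x.obj i + y.obj i
      hom := fun i j hij => x.hom i j hij + y.hom i j hij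
      hom_comp := fun i j k hij hjk => by
        rw [← x.hom_comp i j k hij hjk, ← y.hom_comp i j k hij hjk]
        abel
      obj_eq := fun i j hij => by
        rw [map_add, x.obj_eq i j hij, y.obj_eq i j hij]
        abel }

instance : Zero (AbNerveObj ν n) where
  zero :=
    { obj := fun _ => 0
      hom := fun _ _ _ => 0
      hom_comp := fun _ _ _ _ _ => by simp
      obj_eq := fun _ _ _ => by simp }

instance : Neg (AbNerveObj ν n) where
  neg x :=
    { obj := fun i => -x.obj i
      hom := fun i j hij => -x.hom i j hij
      hom_comp := fun i j k hij hjk => by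
        rw [← x.hom_comp i j k hij hjk]
        abel
      obj_eq := fun i j hij => by
        rw [map_neg, x.obj_eq i j hij]
        abel }

@[simp] lemma add_obj (x y : AbNerveObj ν n) (i) : (x + y).obj i = x.obj i + y.obj i := rfl

@[simp] lemma add_hom (x y : AbNerveObj ν n) (i j hij) :
    (x + y).hom i j hij = x.hom i j hij + y.hom i j hij := rfl

@[simp] lemma zero_obj (i) : (0 : AbNerveObj ν n).obj i = 0 := rfl

@[simp] lemma zero_hom (i j hij) : (0 : AbNerveObj ν n).hom i j hij = 0 := rfl

@[simp] lemma neg_obj (x : AbNerveObj ν n) (i) : (-x).obj i = -x.obj i := rfl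

@[simp] lemma neg_hom (x : AbNerveObj ν n) (i j hij) :
    (-x).hom i j hij = -x.hom i j hij := rfl

instance : AddCommGroup (AbNerveObj ν n) :=
  { AddGroup.ofLeftAxioms (G := AbNerveObj ν n)
      (fun x y z => by ext <;> simp [add_assoc])
      (fun x => by ext <;> simp)
      (fun x => by ext <;> simp) with
    add_comm := fun x y => by ext <;> simp [add_comm] }

/-- The simplicial operator attached to a monotone map `f : [m] → [n]`. -/
def map {m n : ℕ} (f : Fin (m + 1) →o Fin (n + 1)) : AbNerveObj ν n →+ AbNerveObj ν m where
  toFun x :=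
    { obj := fun i => x.obj (f i)
      hom := fun i j hij => x.hom (f i) (f j) (f.monotone hij)
      hom_comp := fun _ _ _ _ _ => x.hom_comp _ _ _ _ _
      obj_eq := fun _ _ _ => x.obj_eq _ _ _ }
  map_zero' := rfl
  map_add' _ _ := rfl

end AbNerveObj

/-- The nerve of an abelian crossed module, a simplicial abelian group. -/
def abNerve (ν : C →+ A) : SimplicialObject AddCommGrpCat.{u} where
  obj n := AddCommGrpCat.of (AbNerveObj ν n.unop.len)
  map f := AddCommGrpCat.ofHom (AbNerveObj.map (ν := ν) f.unop.toOrderHom)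
  map_id _ := rfl
  map_comp _ _ := rfl

/-! ### Actions on abelian crossed modules -/

/-- An action of the crossed module `(H, G, μ)` on the abelian crossed module `(C, A, ν)`: actions
of `G` on `C` and `A`, and a map `ξ : H × A → C`, subject to the standard identities (the group `H`
acts on `C` and `A` through `μ`). -/
structure Action (X : CrossedModule H G) (ν : C →+ A) where
  actC : G →* AddMonoid.End C
  actA : G →* AddMonoid.End A
  ξ : H → A → C
  ν_act : ∀ (g : G) (c : C), ν (actC g c) = actA g (ν c)
  ν_ξ : ∀ (h : H) (a : A), ν (ξ h a) = actA (X.μ h) a - a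
  ξ_ν : ∀ (h : H) (c : C), ξ h (ν c) = actC (X.μ h) c - c
  act_ξ : ∀ (g : G) (h : H) (a : A), actC g (ξ h a) = ξ (X.act g h) (actA g a)
  ξ_mul : ∀ (h h' : H) (a : A), ξ (h * h') a = actC (X.μ h) (ξ h' a) + ξ h a
  ξ_add : ∀ (h : H) (a a' : A), ξ h (a + a') = ξ h a + ξ h a'

end CrossedModule

/-! ### Homology of a simplicial group with coefficients -/

/-- A `Γ`-module `M`, as a linear representation over the integers. (Mathlib's group homology wants
the coefficient ring in the universe of the group, hence the `ULift`.) -/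
def groupModule {Γ M : Type u} [Group Γ] [AddCommGroup M] (ρ : Γ →* AddMonoid.End M) :
    Rep.{u} (ULift.{u} ℤ) Γ :=
  Rep.of (X := M)
    { toFun := fun g =>
        { toFun := ρ g
          map_add' := map_add (ρ g)
          map_smul' := fun r m => map_zsmul (ρ g) r.down m }
      map_one' := by ext m; simp
      map_mul' := fun g g' => by ext m; simp }

/-- A (pointwise) action of a simplicial group `S` on a simplicial abelian group `M`: each `Sₙ`
acts on `Mₙ` by automorphisms, compatibly with the simplicial operators. -/
structure SimplicialAction (S : SimplicialObject GrpCat.{u})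
    (M : SimplicialObject AddCommGrpCat.{u}) where
  act : ∀ n, S.obj n →* AddMonoid.End (M.obj n)
  map_act : ∀ {m n} (f : m ⟶ n) (g : S.obj m) (a : M.obj m),
    M.map f (act m g a) = act n (S.map f g) (M.map f a)

namespace SimplicialAction

variable {S : SimplicialObject GrpCat.{u}} {M : SimplicialObject AddCommGrpCat.{u}}

/-- The morphism of modules `Mₘ → Mₙ` over the group homomorphism `Sₘ → Sₙ` given by a simplicial
operator. -/
def moduleMap (ρ : SimplicialAction S M) {m n} (f : m ⟶ n) :
    groupModule (ρ.act m) ⟶ Rep.res (S.map f).hom (groupModule (ρ.act n)) :=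
  Rep.ofHom
    { toFun := M.map f
      map_add' := map_add (M.map f).hom
      map_smul' := fun r a => map_zsmul (M.map f).hom r.down a
      isIntertwining' := fun g => by
        ext a
        exact ρ.map_act f g a }

/-- The simplicial object `n ↦ B_*(Sₙ) ⊗_{Sₙ} Mₙ` in chain complexes, where `B_*(Γ)` is the bar
resolution. In degree `m` the complex `B_*(Γ) ⊗_Γ M` consists of the sums of symbols
`(1 ⊗ g₁ ⊗ ⋯ ⊗ gₘ) ⊗ a`, that is of the finitely supported functions `Γᵐ → M`; it is Mathlib's
complex of inhomogeneous chains, cf. `groupHomology.inhomogeneousChainsIso`. A simplicial operator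
`f` acts by `b ⊗ a ↦ f b ⊗ f a`. -/
noncomputable def barComplexes (ρ : SimplicialAction S M) :
    SimplicialObject (ChainComplex (ModuleCat.{u} (ULift.{u} ℤ)) ℕ) where
  obj n := groupHomology.inhomogeneousChains (groupModule (ρ.act n))
  map f := groupHomology.chainsMap (S.map f).hom (ρ.moduleMap f)
  map_id n := by
    rw [← groupHomology.chainsMap_id]
    refine groupHomology.chainsMap_congr (by simp) ?_
    ext a
    exact congrArg (fun φ : M.obj n ⟶ M.obj n => φ a) (M.map_id n)
  map_comp {l m n} f g := by
    rw [← groupHomology.chainsMap_comp]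
    refine groupHomology.chainsMap_congr (by simp) ?_
    ext a
    exact congrArg (fun φ : M.obj l ⟶ M.obj n => φ a) (M.map_comp f g)

/-- The bicomplex `B(S, M)`. In position `(p, q)` it is `B_q(Sₚ) ⊗_{Sₚ} Mₚ`. The differential in
the direction of `p` is the alternating sum of the faces, that in the direction of `q` is the one
of the bar complex. -/
noncomputable def bicomplex (ρ : SimplicialAction S M) :
    HomologicalComplex₂ (ModuleCat.{u} (ULift.{u} ℤ)) (ComplexShape.down ℕ)
      (ComplexShape.down ℕ) :=
  (AlgebraicTopology.alternatingFaceMapComplex _).obj ρ.barComplexes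

/-- The `n`th homology group of the simplicial group `S` with coefficients in `M`: the homology of
the total complex of the bicomplex `B(S, M)`. -/
noncomputable def homology (ρ : SimplicialAction S M) (n : ℕ) : ModuleCat.{u} (ULift.{u} ℤ) :=
  (HomologicalComplex₂.total ρ.bicomplex (ComplexShape.down ℕ)).homology n

end SimplicialAction

namespace CrossedModule.Action

variable {H G : Type u} [Group H] [Group G] {X : CrossedModule H G}
variable {C A : Type u} [AddCommGroup C] [AddCommGroup A] {ν : C →+ A}

lemma ξ_zero (α : X.Action ν) (h : H) : α.ξ h 0 = 0 := by
  simpa using α.ξ_add h 0 0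

lemma ξ_one (α : X.Action ν) (a : A) : α.ξ 1 a = 0 := by
  simpa using α.ξ_mul 1 1 a

lemma actA_mul (α : X.Action ν) (g g' : G) (a : A) :
    α.actA (g * g') a = α.actA g (α.actA g' a) := by
  rw [map_mul]; rfl

lemma actC_mul (α : X.Action ν) (g g' : G) (c : C) :
    α.actC (g * g') c = α.actC g (α.actC g' c) := by
  rw [map_mul]; rfl

lemma actA_one (α : X.Action ν) (a : A) : α.actA 1 a = a := by
  rw [map_one]; rfl

lemma actC_one (α : X.Action ν) (c : C) : α.actC 1 c = c := by
  rw [map_one]; rfl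

/-- The action of a simplex of the nerve of `(H, G, μ)` on one of the nerve of `(C, A, ν)`. On
objects it is the action of `G` on `A`. The arrow `(h, g)` sends the arrow `(c, a)` to
`(μ h • g • c + ξ(h, g • a), g • a)`; this is conjugation of `(c, a)` by `(h, g)` in the group of
arrows of the semidirect product of the two crossed modules. Here `μ h * g` is the target of
`(h, g)`. -/
def nerveSMul (α : X.Action ν) {n : ℕ} (x : NerveObj X n) (y : AbNerveObj ν n) :
    AbNerveObj ν n where
  obj i := α.actA (x.obj i) (y.obj i)
  hom i j hij := α.actC (X.μ (x.hom i j hij) * x.obj j) (y.hom i j hij) +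
    α.ξ (x.hom i j hij) (α.actA (x.obj j) (y.obj j))
  hom_comp i j k hij hjk := by
    have e : α.actA (x.obj j) (y.obj j) = ν (α.actC (x.obj j) (y.hom j k hjk)) +
        (ν (α.ξ (x.hom j k hjk) (α.actA (x.obj k) (y.obj k))) +
          α.actA (x.obj k) (y.obj k)) := by
      rw [y.obj_eq j k hjk, map_add, α.ν_act, α.ν_ξ, sub_add_cancel, x.obj_eq j k hjk, actA_mul, actA_mul]
    rw [e, α.ξ_add, α.ξ_add, α.ξ_ν, α.ξ_ν, ← x.obj_eq j k hjk,
      ← x.obj_eq i k (hij.trans hjk), ← x.obj_eq i j hij, ← y.hom_comp i j k hij hjk,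
      ← x.hom_comp i j k hij hjk, α.ξ_mul, map_add, x.obj_eq i j hij, actC_mul, actC_mul]
    abel
  obj_eq i j hij := by
    rw [map_add, α.ν_ξ, α.ν_act, ← x.obj_eq i j hij, y.obj_eq i j hij, map_add,
      add_assoc, sub_add_cancel, x.obj_eq i j hij, ← actA_mul]

/-- The action of the group of `n`-simplices of the nerve of `(H, G, μ)` on that of the nerve of
`(C, A, ν)`. -/
def nerveAct (α : X.Action ν) (n : ℕ) :
    NerveObj X n →* AddMonoid.End (AbNerveObj ν n) where
  toFun x := AddMonoidHom.mk' (α.nerveSMul x) fun y z => by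
    ext
    · simp [nerveSMul]
    · simp only [nerveSMul, AbNerveObj.add_obj, AbNerveObj.add_hom, map_add, α.ξ_add]
      abel
  map_one' := by
    ext y
    · exact α.actA_one _
    · change α.actC (X.μ 1 * 1) _ + α.ξ 1 _ = _
      rw [α.ξ_one, map_one, mul_one, actC_one, add_zero]
      rfl
  map_mul' x x' := by
    ext y i j hij
    · exact α.actA_mul _ _ _
    · change α.actC (X.μ (x.hom i j hij * X.act (x.obj j) (x'.hom i j hij)) *
          (x.obj j * x'.obj j)) (y.hom i j hij) +
          α.ξ (x.hom i j hij * X.act (x.obj j) (x'.hom i j hij))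
            (α.actA (x.obj j * x'.obj j) (y.obj j)) =
        α.actC (X.μ (x.hom i j hij) * x.obj j)
          (α.actC (X.μ (x'.hom i j hij) * x'.obj j) (y.hom i j hij) +
            α.ξ (x'.hom i j hij) (α.actA (x'.obj j) (y.obj j))) +
          α.ξ (x.hom i j hij) (α.actA (x.obj j) (α.actA (x'.obj j) (y.obj j)))
      rw [map_add, ← actC_mul, α.ξ_mul, actC_mul _ (X.μ (x.hom i j hij)) (x.obj j) (α.ξ _ _),
        α.act_ξ (x.obj j), map_mul X.μ, X.precrossed, actA_mul, add_assoc]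
      congr 2
      group

/-- The pointwise action of the nerve of `(H, G, μ)` on the nerve of `(C, A, ν)`. -/
def simplicialAction (α : X.Action ν) : SimplicialAction X.nerve (abNerve ν) where
  act n := α.nerveAct n.unop.len
  map_act _ _ _ := rfl

/-- The `n`th homology group `Hₙ((H, G, μ), (C, A, ν))`. -/
noncomputable def homology (α : X.Action ν) (n : ℕ) : ModuleCat.{u} (ULift.{u} ℤ) :=
  α.simplicialAction.homology n

/-! ### The induced modules `Ker ν` and `A / Im ν` -/

/-- The action of `G` on `Ker ν`. -/
def actKer (α : X.Action ν) : G →* AddMonoid.End ν.ker where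
  toFun g :=
    { toFun := fun c => ⟨α.actC g c, by
        rw [AddMonoidHom.mem_ker, α.ν_act, show ν c = 0 from c.2, map_zero]⟩
      map_zero' := by ext; simp
      map_add' := fun _ _ => by ext; simp }
  map_one' := by ext c; exact α.actC_one c
  map_mul' g g' := by ext c; exact α.actC_mul g g' c

/-- The action of `G` on `A / Im ν`. -/
def actCoker (α : X.Action ν) : G →* AddMonoid.End (A ⧸ ν.range) where
  toFun g := QuotientAddGroup.map ν.range ν.range (α.actA g) <| by
    rintro _ ⟨c, rfl⟩
    exact ⟨α.actC g c, α.ν_act g c⟩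
  map_one' := by
    ext x
    obtain ⟨a, rfl⟩ := QuotientAddGroup.mk_surjective x
    exact congrArg QuotientAddGroup.mk (α.actA_one a)
  map_mul' g g' := by
    ext x
    obtain ⟨a, rfl⟩ := QuotientAddGroup.mk_surjective x
    exact congrArg QuotientAddGroup.mk (α.actA_mul g g' a)

end CrossedModule.Action

namespace CrossedModule.Action

variable {G : Type u} [Group G] {N : Subgroup G} [N.Normal]
variable {C A : Type u} [AddCommGroup C] [AddCommGroup A] {ν : C →+ A}

/-- If `(N, G, σ)` acts on `(C, A, ν)`, then `N` acts trivially on `Ker ν`, so that `Ker ν` is a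
`G / N`-module. -/
def quotientActKer (α : (inclusion N).Action ν) : G ⧸ N →* AddMonoid.End ν.ker :=
  QuotientGroup.lift N α.actKer fun g hg => by
    ext c
    have h := α.ξ_ν ⟨g, hg⟩ c
    rw [show ν c = 0 from c.2, α.ξ_zero] at h
    exact (sub_eq_zero.1 h.symm)

/-- If `(N, G, σ)` acts on `(C, A, ν)`, then `N` acts trivially on `A / Im ν`, so that `A / Im ν`
is a `G / N`-module. -/
def quotientActCoker (α : (inclusion N).Action ν) : G ⧸ N →* AddMonoid.End (A ⧸ ν.range) :=
  QuotientGroup.lift N α.actCoker fun g hg => by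
    ext x
    obtain ⟨a, rfl⟩ := QuotientAddGroup.mk_surjective x
    exact QuotientAddGroup.eq_iff_sub_mem.2 ⟨α.ξ ⟨g, hg⟩ a, α.ν_ξ ⟨g, hg⟩ a⟩

end CrossedModule.Action

/-! Write `G_*` for the nerve of `(N, G, σ)`. There is an exact sequence of simplicial `G_*`-modules
`0 → Ker ν → Nerve(C, C, id) → Nerve(C, A, ν) → A / Im ν → 0` whose outer terms are constant
(`kerToNerve_exact`, `nerveToNerve_exact`). An entry `B_q(G_p) ⊗ A_p` is a direct sum of copies of
`A_p`, so the total complexes again form a four term exact sequence (`totMap_bicomplexMap_exact`).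

The outer two compute the homology of `G / N`. A simplex of `G_*` is a tuple of elements of one
coset, so prepending a chosen representative contracts `G_*` onto `G / N` as a simplicial set, and
every row of the bicomplex onto the chains of `G / N` (`constRowContraction`). The second total
complex is acyclic: a simplex of `Nerve(C, C, id)` is a tuple in `C`, and prepending `0` contracts
it to zero, additively (`onId_acyclic`).

The contractions do not respect the bar differentials, so they exist only row by row. A filtration
by columns still makes the total augmentation a quasi-isomorphism (`quasiIso_totMap`). Finally, a
four term exact sequence `0 → K → E → A → Q → 0` with `E` acyclic splits into two short ones. One of
them shifts the homology of `K` up by one degree, the other gives the long exact sequence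
(`exists_long_exact_of_acyclic`). -/

namespace HomologicalComplex₂

/-! ### Total complexes of first quadrant bicomplexes. -/

variable {R : Type u} [CommRing R]

/-- First quadrant bicomplexes of `R`-modules. -/
abbrev FirstQuadrant (R : Type u) [CommRing R] :=
  HomologicalComplex₂ (ModuleCat.{u} R) (ComplexShape.down ℕ) (ComplexShape.down ℕ)

namespace FirstQuadrant

variable (K L M : FirstQuadrant R)

/-- The total complex. -/
noncomputable abbrev tot : ChainComplex (ModuleCat.{u} R) ℕ := K.total (ComplexShape.down ℕ)

/-- The inclusion of a summand of the total complex. -/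
noncomputable abbrev inc (p q n : ℕ) (h : p + q = n) : (K.X p).X q ⟶ K.tot.X n :=
  K.ιTotal (ComplexShape.down ℕ) p q n h

/-- The projection of the total complex to a summand. -/
noncomputable def proj (p q n : ℕ) (h : p + q = n) : K.tot.X n ⟶ (K.X p).X q :=
  K.totalDesc fun p' q' h' =>
    if e : p' = p then
      (K.XXIsoOfEq _ _ _ e (by change p' + q' = n at h'; omega)).hom
    else 0

variable {K L M}

lemma inc_proj (p q n : ℕ) (h : p + q = n) : K.inc p q n h ≫ K.proj p q n h = 𝟙 _ := by
  simp [proj]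

lemma inc_proj_of_ne (p q p' q' n : ℕ) (h : p + q = n) (h' : p' + q' = n) (hp : p' ≠ p) :
    K.inc p' q' n h' ≫ K.proj p q n h = 0 := by
  simp [proj, hp]

/-- Only the finitely many summands with `p + q = n` occur in degree `n`, so the total complex is
degreewise a finite biproduct. Injectivity, surjectivity and exactness can therefore be checked
entry by entry. -/
lemma sum_proj_inc (n : ℕ) :
    ∑ s : Finset.HasAntidiagonal.antidiagonal n,
      K.proj s.1.1 s.1.2 n (Finset.HasAntidiagonal.mem_antidiagonal.1 s.2) ≫
        K.inc s.1.1 s.1.2 n (Finset.HasAntidiagonal.mem_antidiagonal.1 s.2) = 𝟙 (K.tot.X n) := by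
  refine total.hom_ext _ fun p q h => ?_
  rw [Preadditive.comp_sum, Finset.sum_eq_single ⟨(p, q), Finset.HasAntidiagonal.mem_antidiagonal.2 h⟩]
  · rw [← Category.assoc]
    erw [inc_proj]
    simp
  · rintro ⟨⟨p', q'⟩, hs⟩ - hne
    rw [Finset.HasAntidiagonal.mem_antidiagonal] at hs
    rw [← Category.assoc]
    erw [inc_proj_of_ne]
    · simp
    · rintro rfl
      change p + q = n at h
      obtain rfl : q = q' := by simp at hs; omega
      exact hne rfl
  · simp

lemma sum_inc_proj_apply {n : ℕ} (x : K.tot.X n) :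
    x = ∑ s : Finset.HasAntidiagonal.antidiagonal n, K.inc s.1.1 s.1.2 n (Finset.HasAntidiagonal.mem_antidiagonal.1 s.2)
      (K.proj s.1.1 s.1.2 n (Finset.HasAntidiagonal.mem_antidiagonal.1 s.2) x) := by
  have := congr($(sum_proj_inc (K := K) n).hom x)
  rw [ModuleCat.hom_sum, LinearMap.sum_apply] at this
  exact this.symm

/-- The morphism of total complexes induced by a morphism of bicomplexes. -/
noncomputable abbrev totMap (φ : K ⟶ L) : K.tot ⟶ L.tot := total.map φ (ComplexShape.down ℕ)

lemma inc_totMap (φ : K ⟶ L) (p q n : ℕ) (h : p + q = n) :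
    K.inc p q n h ≫ (totMap φ).f n = (φ.f p).f q ≫ L.inc p q n h := by
  simp [totMap]

lemma totMap_proj (φ : K ⟶ L) (p q n : ℕ) (h : p + q = n) :
    (totMap φ).f n ≫ L.proj p q n h = K.proj p q n h ≫ (φ.f p).f q := by
  refine total.hom_ext _ fun p' q' h' => ?_
  by_cases e : p' = p
  · subst e
    obtain rfl : q = q' := by change p' + q' = n at h'; omega
    erw [← Category.assoc, inc_totMap, Category.assoc, inc_proj, ← Category.assoc, inc_proj]
    simp
  · erw [← Category.assoc, inc_totMap, Category.assoc, inc_proj_of_ne _ _ _ _ _ _ _ e,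
      ← Category.assoc, inc_proj_of_ne _ _ _ _ _ _ _ e]
    simp

lemma inc_totMap_apply (φ : K ⟶ L) (p q n : ℕ) (h : p + q = n) (b : (K.X p).X q) :
    (totMap φ).f n (K.inc p q n h b) = L.inc p q n h ((φ.f p).f q b) :=
  congr($(inc_totMap φ p q n h).hom b)

lemma totMap_proj_apply (φ : K ⟶ L) (p q n : ℕ) (h : p + q = n) (x : K.tot.X n) :
    L.proj p q n h ((totMap φ).f n x) = (φ.f p).f q (K.proj p q n h x) :=
  congr($(totMap_proj φ p q n h).hom x)

lemma totMap_injective (φ : K ⟶ L) (hφ : ∀ p q, Function.Injective ((φ.f p).f q)) (n : ℕ) :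
    Function.Injective ((totMap φ).f n) := by
  refine (injective_iff_map_eq_zero ((totMap φ).f n).hom).2 fun x hx => ?_
  rw [sum_inc_proj_apply x]
  refine Finset.sum_eq_zero fun s _ => ?_
  have : K.proj s.1.1 s.1.2 n (Finset.HasAntidiagonal.mem_antidiagonal.1 s.2) x = 0 := by
    apply hφ
    rw [← totMap_proj_apply]
    erw [hx]
    simp
  rw [this, map_zero]

lemma totMap_surjective (φ : K ⟶ L) (hφ : ∀ p q, Function.Surjective ((φ.f p).f q)) (n : ℕ) :
    Function.Surjective ((totMap φ).f n) := by
  intro y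
  choose g hg using hφ
  refine ⟨∑ s : Finset.HasAntidiagonal.antidiagonal n, K.inc s.1.1 s.1.2 n (Finset.HasAntidiagonal.mem_antidiagonal.1 s.2)
      (g _ _ (L.proj s.1.1 s.1.2 n (Finset.HasAntidiagonal.mem_antidiagonal.1 s.2) y)), ?_⟩
  conv_rhs => rw [sum_inc_proj_apply y]
  rw [map_sum]
  refine Finset.sum_congr rfl fun s _ => ?_
  rw [inc_totMap_apply, hg]

lemma totMap_exact (φ : K ⟶ L) (ψ : L ⟶ M)
    (h : ∀ p q, Function.Exact ((φ.f p).f q) ((ψ.f p).f q)) (n : ℕ) :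
    Function.Exact ((totMap φ).f n) ((totMap ψ).f n) := by
  intro y
  constructor
  · intro hy
    have hy' : ∀ s : Finset.HasAntidiagonal.antidiagonal n, ∃ b, (φ.f s.1.1).f s.1.2 b =
        L.proj s.1.1 s.1.2 n (Finset.HasAntidiagonal.mem_antidiagonal.1 s.2) y := fun s => by
      apply (h _ _ _).1
      rw [← totMap_proj_apply, hy, map_zero]
    choose b hb using hy'
    refine ⟨∑ s, K.inc _ _ n (Finset.HasAntidiagonal.mem_antidiagonal.1 s.2) (b s), ?_⟩
    conv_rhs => rw [sum_inc_proj_apply y]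
    rw [map_sum]
    refine Finset.sum_congr rfl fun s _ => ?_
    rw [inc_totMap_apply, hb]
  · rintro ⟨x, rfl⟩
    rw [sum_inc_proj_apply x, map_sum, map_sum]
    refine Finset.sum_eq_zero fun s _ => ?_
    rw [inc_totMap_apply, inc_totMap_apply, (h _ _).apply_apply_eq_zero, map_zero]

end FirstQuadrant
end HomologicalComplex₂

/-! ### Contractible rows and the column filtration. -/

namespace HomologicalComplex₂
namespace FirstQuadrant

variable {R : Type u} [CommRing R] {K : FirstQuadrant R}

lemma inc_d_succ_zero (p n : ℕ) (h : p + 1 + 0 = n + 1) (b : (K.X (p + 1)).X 0) :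
    K.tot.d (n + 1) n (K.inc (p + 1) 0 (n + 1) h b) =
      K.inc p 0 n (by omega) ((K.d (p + 1) p).f 0 b) := by
  have : K.inc (p + 1) 0 (n + 1) h ≫ K.tot.d (n + 1) n =
      (K.d (p + 1) p).f 0 ≫ K.inc p 0 n (by omega) := by
    rw [total_d, Preadditive.comp_add, ι_D₁, ι_D₂,
      d₁_eq K _ (show (ComplexShape.down ℕ).Rel (p + 1) p from rfl) 0 n
        (by change p + 0 = n; omega), d₂_eq_zero]
    · erw [one_smul, add_zero]
    · simp
  exact congr($(this).hom b)

/-- The sign of the vertical differential of the total complex. -/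
abbrev sgn (p q : ℕ) : ℤˣ :=
  ComplexShape.ε₂ (ComplexShape.down ℕ) (ComplexShape.down ℕ) (ComplexShape.down ℕ) (p, q)

/-- The horizontal differential enters the total one without a sign. The vertical sign never has to
be evaluated: vertical terms are pushed one column to the right in the argument below. -/
lemma inc_d_succ_succ (p q n : ℕ) (h : p + 1 + (q + 1) = n + 1) (b : (K.X (p + 1)).X (q + 1)) :
    K.tot.d (n + 1) n (K.inc (p + 1) (q + 1) (n + 1) h b) =
      K.inc p (q + 1) n (by omega) ((K.d (p + 1) p).f (q + 1) b) +
      sgn (p + 1) (q + 1) • K.inc (p + 1) q n (by omega) ((K.X (p + 1)).d (q + 1) q b) := by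
  have : K.inc (p + 1) (q + 1) (n + 1) h ≫ K.tot.d (n + 1) n =
      (K.d (p + 1) p).f (q + 1) ≫ K.inc p (q + 1) n (by omega) +
      sgn (p + 1) (q + 1) • (K.X (p + 1)).d (q + 1) q ≫ K.inc (p + 1) q n (by omega) := by
    rw [total_d, Preadditive.comp_add, ι_D₁, ι_D₂,
      d₁_eq K _ (show (ComplexShape.down ℕ).Rel (p + 1) p from rfl) (q + 1) n
        (by change p + (q + 1) = n; omega),
      d₂_eq K _ (p + 1) (show (ComplexShape.down ℕ).Rel (q + 1) q from rfl) n
        (by change p + 1 + q = n; omega)]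
    erw [one_smul]
  exact congr($(this).hom b)

lemma inc_d_zero_succ (q n : ℕ) (h : 0 + (q + 1) = n + 1) (b : (K.X 0).X (q + 1)) :
    K.tot.d (n + 1) n (K.inc 0 (q + 1) (n + 1) h b) =
      K.inc 0 q n (by omega) ((K.X 0).d (q + 1) q b) := by
  have : K.inc 0 (q + 1) (n + 1) h ≫ K.tot.d (n + 1) n =
      (K.X 0).d (q + 1) q ≫ K.inc 0 q n (by omega) := by
    rw [total_d, Preadditive.comp_add, ι_D₁, ι_D₂, d₁_eq_zero,
      d₂_eq K _ 0 (show (ComplexShape.down ℕ).Rel (q + 1) q from rfl) n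
        (by change 0 + q = n; omega)]
    · erw [one_smul, zero_add]
    · simp
  exact congr($(this).hom b)

/-- The filtration of the total complex by columns. -/
noncomputable def filtration (K : FirstQuadrant R) (n k : ℕ) : Submodule R (K.tot.X n) :=
  Submodule.span R {x | ∃ (p q : ℕ) (h : p + q = n) (b : (K.X p).X q),
    k ≤ p ∧ K.inc p q n h b = x}

lemma inc_mem_filtration {p q n k : ℕ} (h : p + q = n) (hk : k ≤ p) (b : (K.X p).X q) :
    K.inc p q n h b ∈ K.filtration n k :=
  Submodule.subset_span ⟨p, q, h, b, hk, rfl⟩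

lemma filtration_zero (n : ℕ) : K.filtration n 0 = ⊤ := by
  refine eq_top_iff.2 fun x _ => ?_
  rw [sum_inc_proj_apply x]
  exact Submodule.sum_mem _ fun s _ => inc_mem_filtration _ (Nat.zero_le _) _

/-- Columns beyond the `n`th do not meet total degree `n`. This makes the successive approximation
in `exists_d_eq` stop. -/
lemma eq_zero_of_mem_filtration {n : ℕ} {x : K.tot.X n} (hx : x ∈ K.filtration n (n + 1)) :
    x = 0 := by
  have : K.filtration n (n + 1) = ⊥ := by
    refine Submodule.span_eq_bot.2 ?_
    rintro x ⟨p, q, h, b, hp, rfl⟩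
    omega
  rwa [this, Submodule.mem_bot] at hx

/-- A row-wise contraction of a bicomplex onto a complex augmenting it. -/
structure RowContraction (K : FirstQuadrant R) (E : ChainComplex (ModuleCat.{u} R) ℕ) where
  ε : K.X 0 ⟶ E
  d_ε : K.d 1 0 ≫ ε = 0
  η (q : ℕ) : E.X q ⟶ (K.X 0).X q
  h (p q : ℕ) : (K.X p).X q ⟶ (K.X (p + 1)).X q
  η_ε (q : ℕ) (e : E.X q) : ε.f q (η q e) = e
  d_h_zero (q : ℕ) (b : (K.X 0).X q) : (K.d 1 0).f q (h 0 q b) = b - η q (ε.f q b)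
  d_h_succ (p q : ℕ) (b : (K.X (p + 1)).X q) :
    (K.d (p + 2) (p + 1)).f q (h (p + 1) q b) = b - h p q ((K.d (p + 1) p).f q b)

namespace RowContraction

variable {E : ChainComplex (ModuleCat.{u} R) ℕ} (c : RowContraction K E)

/-- The augmentation on a summand of the total complex. -/
noncomputable def summandMap (n : ℕ) :
    ∀ (p q : ℕ) (_ : p + q = n), (K.X p).X q ⟶ E.X n
  | 0, q, h => c.ε.f q ≫ (E.XIsoOfEq (by omega)).hom
  | _ + 1, _, _ => 0

/-- The augmentation of the total complex, in degree `n`. -/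
noncomputable def totMapF (n : ℕ) : K.tot.X n ⟶ E.X n :=
  K.totalDesc (c.summandMap n)

lemma totMapF_inc_zero (n : ℕ) (h : 0 + n = n) (b : (K.X 0).X n) :
    c.totMapF n (K.inc 0 n n h b) = c.ε.f n b := by
  have : K.inc 0 n n h ≫ c.totMapF n = c.ε.f n := by
    simp [totMapF, summandMap]
  exact congr($(this).hom b)

lemma totMapF_inc_succ (p q n : ℕ) (h : p + 1 + q = n) (b : (K.X (p + 1)).X q) :
    c.totMapF n (K.inc (p + 1) q n h b) = 0 := by
  have : K.inc (p + 1) q n h ≫ c.totMapF n = 0 := by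
    simp [totMapF, summandMap]
  exact congr($(this).hom b)

lemma totMapF_d (n : ℕ) (x : K.tot.X (n + 1)) :
    E.d (n + 1) n (c.totMapF (n + 1) x) = c.totMapF n (K.tot.d (n + 1) n x) := by
  have key : ∀ (p q : ℕ) (h : p + q = n + 1) (b : (K.X p).X q),
      E.d (n + 1) n (c.totMapF (n + 1) (K.inc p q (n + 1) h b)) =
        c.totMapF n (K.tot.d (n + 1) n (K.inc p q (n + 1) h b)) := by
    intro p q h b
    match p, q, h, b with
    | 0, q + 1, h, b =>
      obtain rfl : q = n := by omega
      rw [inc_d_zero_succ, totMapF_inc_zero, totMapF_inc_zero]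
      exact congr($(c.ε.comm (q + 1) q).hom b)
    | 1, 0, h, b =>
      obtain rfl : n = 0 := by omega
      rw [inc_d_succ_zero, totMapF_inc_succ, totMapF_inc_zero, map_zero]
      exact congr(($(c.d_ε).f 0).hom b).symm
    | p + 2, 0, h, b =>
      rw [inc_d_succ_zero, totMapF_inc_succ, totMapF_inc_succ, map_zero]
    -- Column 1 is the only place where `d_ε` is needed: its horizontal differential lands in column
    -- 0, where the augmentation is nonzero.
    | 1, q + 1, h, b =>
      obtain rfl : n = q + 1 := by omega
      rw [inc_d_succ_succ, totMapF_inc_succ, map_add, Units.smul_def, map_zsmul,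
        totMapF_inc_zero, totMapF_inc_succ, map_zero, smul_zero, add_zero]
      exact congr(($(c.d_ε).f (q + 1)).hom b).symm
    | p + 2, q + 1, h, b =>
      rw [inc_d_succ_succ, totMapF_inc_succ, map_add, Units.smul_def, map_zsmul,
        totMapF_inc_succ, totMapF_inc_succ, map_zero, smul_zero, add_zero]
  rw [sum_inc_proj_apply x]
  simp only [map_sum]
  exact Finset.sum_congr rfl fun s _ => key _ _ _ _

/-- The augmentation of the total complex. -/
noncomputable def totMap : K.tot ⟶ E where
  f := c.totMapF
  comm' i j hij := by
    obtain rfl : j + 1 = i := hij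
    ext x
    exact c.totMapF_d j x

/-- The homotopy on the total complex given by the contractions of the rows. -/
noncomputable def totH (n : ℕ) : K.tot.X n ⟶ K.tot.X (n + 1) :=
  K.totalDesc fun p q h => c.h p q ≫ K.inc (p + 1) q (n + 1)
    (by change p + q = n at h; omega)

lemma totH_inc (p q n : ℕ) (h : p + q = n) (b : (K.X p).X q) :
    c.totH n (K.inc p q n h b) = K.inc (p + 1) q (n + 1) (by omega) (c.h p q b) := by
  have : K.inc p q n h ≫ c.totH n = c.h p q ≫ K.inc (p + 1) q (n + 1) (by omega) := by
    simp [totH]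
  exact congr($(this).hom b)

lemma totMapF_totH (n : ℕ) (x : K.tot.X n) : c.totMapF (n + 1) (c.totH n x) = 0 := by
  rw [sum_inc_proj_apply x]
  simp only [map_sum]
  refine Finset.sum_eq_zero fun s _ => ?_
  rw [totH_inc, totMapF_inc_succ]

/-- The composite of the differential and the homotopy. -/
noncomputable def dTotH : ∀ n : ℕ, K.tot.X n ⟶ K.tot.X n
  -- Nothing lies below degree 0, so this term of the homotopy formula is zero there.
  | 0 => 0
  | n + 1 => K.tot.d (n + 1) n ≫ c.totH n

lemma dTotH_eq_zero (n : ℕ) (x : K.tot.X n) (hx : ∀ j, K.tot.d n j x = 0) : c.dTotH n x = 0 := by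
  cases n with
  | zero => rfl
  | succ n =>
    change c.totH n (K.tot.d (n + 1) n x) = 0
    rw [hx, map_zero]

/-- The horizontal terms cancel by the contraction identities. What remains measures the failure of
`h` to be compatible with the vertical differential, and it lies one column further to the right
since `h` raises `p`. -/
lemma homotopy_mem_of_mem (n k : ℕ) {x : K.tot.X n} (hx : x ∈ K.filtration n k) :
    (K.tot.d (n + 1) n (c.totH n x) + c.dTotH n x - x +
      K.inc 0 n n (by omega) (c.η n (c.totMapF n x))) ∈ K.filtration n (k + 1) := by
  have key : ∀ (p q : ℕ) (h : p + q = n) (b : (K.X p).X q), ∃ y ∈ K.filtration n (p + 1),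
      K.tot.d (n + 1) n (c.totH n (K.inc p q n h b)) + c.dTotH n (K.inc p q n h b) -
        K.inc p q n h b +
      K.inc 0 n n (by omega) (c.η n (c.totMapF n (K.inc p q n h b))) = y := by
    intro p q h b
    match p, q, h, b with
    | 0, 0, h, b =>
      obtain rfl : n = 0 := by omega
      refine ⟨0, zero_mem _, ?_⟩
      change _ + (0 : K.tot.X 0) - _ + _ = _
      rw [totH_inc, inc_d_succ_zero, totMapF_inc_zero, c.d_h_zero, map_sub]
      abel
    | 0, q + 1, h, b =>
      obtain rfl : n = q + 1 := by omega
      refine ⟨sgn (0 + 1) (q + 1) • K.inc (0 + 1) q (q + 1) (by omega)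
          ((K.X (0 + 1)).d (q + 1) q (c.h 0 (q + 1) b)) +
        K.inc (0 + 1) q (q + 1) (by omega) (c.h 0 q ((K.X 0).d (q + 1) q b)), ?_, ?_⟩
      · exact add_mem (Submodule.smul_of_tower_mem _ _ (inc_mem_filtration _ (by omega) _))
          (inc_mem_filtration _ (by omega) _)
      · change _ + c.totH _ (K.tot.d _ _ _) - _ + _ = _
        rw [totH_inc, inc_d_succ_succ, totMapF_inc_zero, c.d_h_zero, map_sub, inc_d_zero_succ,
          totH_inc]
        abel
    | p + 1, 0, h, b =>
      obtain rfl : n = p + 1 := by omega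
      refine ⟨0, zero_mem _, ?_⟩
      change _ + c.totH _ (K.tot.d _ _ _) - _ + _ = _
      rw [totH_inc, inc_d_succ_zero, totMapF_inc_succ, c.d_h_succ, map_sub, inc_d_succ_zero,
        totH_inc, map_zero, map_zero]
      abel
    | p + 1, q + 1, h, b =>
      obtain rfl : n = p + q + 1 + 1 := by omega
      refine ⟨sgn (p + 1 + 1) (q + 1) • K.inc (p + 1 + 1) q (p + q + 1 + 1) (by omega)
          ((K.X (p + 1 + 1)).d (q + 1) q (c.h (p + 1) (q + 1) b)) +
        (sgn (p + 1) (q + 1) : ℤ) • K.inc (p + 1 + 1) q (p + q + 1 + 1) (by omega)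
          (c.h (p + 1) q ((K.X (p + 1)).d (q + 1) q b)), ?_, ?_⟩
      · exact add_mem (Submodule.smul_of_tower_mem _ _ (inc_mem_filtration _ (by omega) _))
          (Submodule.smul_of_tower_mem _ _ (inc_mem_filtration _ (by omega) _))
      · change _ + c.totH _ (K.tot.d _ _ _) - _ + _ = _
        rw [totH_inc, inc_d_succ_succ, totMapF_inc_succ, c.d_h_succ, map_sub, inc_d_succ_succ,
          map_add, Units.smul_def (sgn (p + 1) (q + 1)), map_zsmul, totH_inc, totH_inc,
          map_zero, map_zero]
        abel
  have le : K.filtration n k ≤ (K.filtration n (k + 1)).comap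
      (c.totH n ≫ K.tot.d (n + 1) n + c.dTotH n - 𝟙 _ +
        c.totMapF n ≫ c.η n ≫ K.inc 0 n n (by omega)).hom := by
    refine Submodule.span_le.2 ?_
    rintro _ ⟨p, q, h, b, hp, rfl⟩
    obtain ⟨y, hy, e⟩ := key p q h b
    change _ ∈ K.filtration n (k + 1)
    refine Eq.subst e.symm ?_ (motive := fun z => z ∈ K.filtration n (k + 1))
    refine Submodule.span_mono ?_ hy
    rintro _ ⟨p', q', h', b', hp', rfl⟩
    exact ⟨p', q', h', b', by omega, rfl⟩
  exact le hx

/-- Replacing `y` by `y + totH (x - d y)` moves the error `x - d y` one column to the right, and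
`totH` has image in the kernel of the augmentation. After `n + 1` corrections no column is left. -/
lemma exists_d_eq (n : ℕ) (x : K.tot.X n) (hx : ∀ j, K.tot.d n j x = 0)
    (hε : c.totMapF n x = 0) :
    ∃ y : K.tot.X (n + 1), K.tot.d (n + 1) n y = x ∧ c.totMapF (n + 1) y = 0 := by
  have step : ∀ k, ∃ y : K.tot.X (n + 1), c.totMapF (n + 1) y = 0 ∧
      x - K.tot.d (n + 1) n y ∈ K.filtration n k := by
    intro k
    induction k with
    | zero => exact ⟨0, map_zero _, by rw [filtration_zero]; trivial⟩
    | succ k ih =>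
      obtain ⟨y, hy, hm⟩ := ih
      have hd : ∀ j, K.tot.d n j (x - K.tot.d (n + 1) n y) = 0 := fun j => by
        rw [map_sub, hx, zero_sub, neg_eq_zero]
        exact congr($(K.tot.d_comp_d (n + 1) n j).hom y)
      have hε' : c.totMapF n (x - K.tot.d (n + 1) n y) = 0 := by
        rw [map_sub, hε, ← totMapF_d, hy, map_zero, sub_zero]
      have := c.homotopy_mem_of_mem n k hm
      rw [c.dTotH_eq_zero n _ hd, hε', map_zero, map_zero, add_zero, add_zero] at this
      refine ⟨y + c.totH n (x - K.tot.d (n + 1) n y), ?_, ?_⟩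
      · rw [map_add, hy, totMapF_totH, zero_add]
      · rw [← neg_mem_iff]
        convert this using 1
        rw [map_add]
        abel
  obtain ⟨y, hy, hm⟩ := step (n + 1)
  exact ⟨y, (sub_eq_zero.1 (eq_zero_of_mem_filtration hm)).symm, hy⟩

lemma totMapF_surjective (n : ℕ) : Function.Surjective (c.totMapF n) := fun e =>
  ⟨K.inc 0 n n (by omega) (c.η n e), by rw [totMapF_inc_zero, η_ε]⟩

/-- The augmentation of a bicomplex with contractible augmented rows is a quasi-isomorphism. -/
lemma quasiIso_totMap : QuasiIso c.totMap := by
  have : ∀ n, Epi (c.totMap.f n) := fun n =>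
    (ModuleCat.epi_iff_surjective _).2 (c.totMapF_surjective n)
  have : Epi c.totMap := HomologicalComplex.epi_of_epi_f _ this
  -- The augmentation is degreewise surjective, so it suffices that its kernel is acyclic. This is
  -- `exists_d_eq`, whose second clause places the primitive in the kernel.
  let S := ShortComplex.kernelSequence c.totMap
  have hS : S.ShortExact :=
    { exact := ShortComplex.kernelSequence_exact _
      mono_f := by dsimp [S]; infer_instance
      epi_g := this }
  have hS' : ∀ n, (S.map (HomologicalComplex.eval _ _ n)).ShortExact := fun n =>
    hS.map_of_exact _
  have hex : S.X₁.Acyclic := by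
    intro n
    rw [S.X₁.exactAt_iff' (n + 1) n ((ComplexShape.down ℕ).next n) (by simp) rfl,
      ShortComplex.moduleCat_exact_iff]
    intro x hx
    have hx' : ∀ j, S.X₁.d n j x = 0 := fun j => by
      by_cases h : (ComplexShape.down ℕ).Rel n j
      · rw [← (ComplexShape.down ℕ).next_eq' h]
        exact hx
      · rw [S.X₁.shape _ _ h]; rfl
    obtain ⟨y, hy, hy'⟩ := c.exists_d_eq n (S.f.f n x) (fun j => by
        have := congr($(S.f.comm n j).hom x)
        refine this.trans ?_
        change (S.f.f j) (S.X₁.d n j x) = 0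
        rw [hx', map_zero]) congr(($(S.zero).f n).hom x)
    obtain ⟨z, hz⟩ := (ShortComplex.moduleCat_exact_iff _).1 (hS' (n + 1)).exact y hy'
    refine ⟨z, ?_⟩
    apply (ModuleCat.mono_iff_injective _).1 (hS' n).mono_f
    have := congr($(S.f.comm (n + 1) n).hom z)
    refine this.symm.trans (Eq.trans ?_ hy)
    exact congr((ConcreteCategory.hom (K.tot.d (n + 1) n)) $hz)
  refine ⟨fun n => (quasiIsoAt_iff_isIso_homologyMap _ _).2 ?_⟩
  have zero : ∀ j, Limits.IsZero (S.X₁.homology j) := fun j =>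
    (HomologicalComplex.exactAt_iff_isZero_homology _ _).1 (hex j)
  have : Mono (HomologicalComplex.homologyMap c.totMap n) :=
    (hS.homology_exact₂ n).mono_g ((zero n).eq_of_src _ _)
  have : Epi (HomologicalComplex.homologyMap c.totMap n) := by
    -- In degree 0 there is no connecting map; there an epimorphism of complexes is already onto in
    -- homology.
    by_cases! hn : ∃ j, (ComplexShape.down ℕ).Rel n j
    · obtain ⟨j, hj⟩ := hn
      exact (hS.homology_exact₃ n j hj).epi_f ((zero j).eq_of_tgt _ _)
    · exact HomologicalComplex.epi_homologyMap_of_epi_of_not_rel _ _ hn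
  exact isIso_of_mono_of_epi _

end RowContraction

end FirstQuadrant
end HomologicalComplex₂

/-! ### Homological algebra of four term exact sequences. -/

/-- The long exact homology sequence of a four term exact sequence `0 → K → E → A → Q → 0` of
chain complexes with `E` acyclic. -/
lemma ChainComplex.exists_long_exact_of_acyclic {R : Type u} [CommRing R]
    {K E A Q : ChainComplex (ModuleCat.{u} R) ℕ} (f : K ⟶ E) (g : E ⟶ A) (h : A ⟶ Q)
    (hf : ∀ n, Function.Injective (f.f n)) (hfg : ∀ n, Function.Exact (f.f n) (g.f n))
    (hgh : ∀ n, Function.Exact (g.f n) (h.f n)) (hh : ∀ n, Function.Surjective (h.f n))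
    (hE : E.Acyclic) :
    ∃ (i : ∀ n, K.homology n ⟶ A.homology (n + 1)) (d : ∀ n, Q.homology (n + 2) ⟶ K.homology n),
      (∀ n, Function.Exact (i n) (HomologicalComplex.homologyMap h (n + 1))) ∧
      (∀ n, Function.Exact (HomologicalComplex.homologyMap h (n + 2)) (d n)) ∧
      (∀ n, Function.Exact (d n) (i n)) ∧
      Function.Surjective (HomologicalComplex.homologyMap h 1) ∧
      Function.Bijective (HomologicalComplex.homologyMap h 0) := by
  have wfg : f ≫ g = 0 := by
    ext n x
    exact (hfg n).apply_apply_eq_zero x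
  have wgh : g ≫ h = 0 := by
    ext n x
    exact (hgh n).apply_apply_eq_zero x
  have : Mono f := HomologicalComplex.mono_of_mono_f _ fun n =>
    (ModuleCat.mono_iff_injective _).2 (hf n)
  have : Epi h := HomologicalComplex.epi_of_epi_f _ fun n =>
    (ModuleCat.epi_iff_surjective _).2 (hh n)
  have efg : (ShortComplex.mk f g wfg).Exact :=
    HomologicalComplex.exact_of_degreewise_exact _ fun n =>
      (ShortComplex.ShortExact.moduleCat_exact_iff_function_exact _).2 (hfg n)
  have egh : (ShortComplex.mk g h wgh).Exact :=
    HomologicalComplex.exact_of_degreewise_exact _ fun n =>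
      (ShortComplex.ShortExact.moduleCat_exact_iff_function_exact _).2 (hgh n)
  -- The sequence is cut at `Z = ker h`: `S` is `0 → Z → A → Q → 0` and `T` is `0 → K → E → Z → 0`.
  let S := ShortComplex.kernelSequence h
  have hS : S.ShortExact :=
    { exact := ShortComplex.kernelSequence_exact _
      mono_f := by dsimp [S]; infer_instance
      epi_g := ‹Epi h› }
  let g' : E ⟶ Limits.kernel h := Limits.kernel.lift h g wgh
  let T : ShortComplex (ChainComplex (ModuleCat.{u} R) ℕ) := ShortComplex.mk f g' (by
    rw [← cancel_mono (Limits.kernel.ι h)]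
    simp [g', wfg])
  have hT : T.ShortExact :=
    { exact := by
        let φ : T ⟶ ShortComplex.mk f g wfg :=
          { τ₁ := 𝟙 _, τ₂ := 𝟙 _, τ₃ := Limits.kernel.ι h
            comm₂₃ := by simp [T, g'] }
        have : Epi φ.τ₁ := by dsimp [φ]; infer_instance
        have : IsIso φ.τ₂ := by dsimp [φ]; infer_instance
        have : Mono φ.τ₃ := by dsimp [φ]; infer_instance
        exact (ShortComplex.exact_iff_of_epi_of_isIso_of_mono φ).2 efg
      mono_f := by dsimp [T]; infer_instance
      epi_g := egh.epi_kernelLift }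
  have zero : ∀ j, Limits.IsZero (E.homology j) := fun j =>
    (HomologicalComplex.exactAt_iff_isZero_homology _ _).1 (hE j)
  -- Since `E` is acyclic, the connecting maps of `T` are isomorphisms; this is the dimension shift.
  let e : ∀ n, (Limits.kernel h).homology (n + 1) ≅ K.homology n := fun n =>
    hT.δIso (n + 1) n rfl (zero _) (zero _)
  -- `H₀` preserves the surjection `E → ker h`. This vanishing gives surjectivity in degree 1 and
  -- injectivity in degree 0 at the end of the sequence.
  have zero' : Limits.IsZero ((Limits.kernel h).homology 0) := by
    have : Epi (HomologicalComplex.homologyMap g' 0) :=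
      have : Epi g' := hT.epi_g
      HomologicalComplex.epi_homologyMap_of_epi_of_not_rel g' 0 (by simp)
    exact Limits.IsZero.of_epi (HomologicalComplex.homologyMap g' 0) (zero 0)
  have e2 : ∀ n, Function.Exact (HomologicalComplex.homologyMap S.f n)
      (HomologicalComplex.homologyMap h n) := fun n =>
    (ShortComplex.ShortExact.moduleCat_exact_iff_function_exact _).1 (hS.homology_exact₂ n)
  have e3 : ∀ n, Function.Exact (HomologicalComplex.homologyMap h (n + 1))
      (hS.δ (n + 1) n rfl) := fun n =>
    (ShortComplex.ShortExact.moduleCat_exact_iff_function_exact _).1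
      (hS.homology_exact₃ (n + 1) n rfl)
  have e1 : ∀ n, Function.Exact (hS.δ (n + 1) n rfl)
      (HomologicalComplex.homologyMap S.f n) := fun n =>
    (ShortComplex.ShortExact.moduleCat_exact_iff_function_exact _).1
      (hS.homology_exact₁ (n + 1) n rfl)
  have einj : ∀ n, Function.Injective (e n).hom := fun n =>
    (ModuleCat.mono_iff_injective _).1 inferInstance
  have hom_inv : ∀ n x, (e n).inv ((e n).hom x) = x := fun n x =>
    congr($((e n).hom_inv_id).hom x)
  have inv_hom : ∀ n x, (e n).hom ((e n).inv x) = x := fun n x =>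
    congr($((e n).inv_hom_id).hom x)
  refine ⟨fun n => (e n).inv ≫ HomologicalComplex.homologyMap S.f (n + 1),
    fun n => hS.δ (n + 2) (n + 1) rfl ≫ (e n).hom, ?_, ?_, ?_, ?_, ?_, ?_⟩
  · intro n x
    rw [e2 (n + 1) x]
    constructor
    · rintro ⟨y, rfl⟩
      exact ⟨(e n).hom y, congrArg (HomologicalComplex.homologyMap S.f (n + 1)) (hom_inv n y)⟩
    · rintro ⟨y, rfl⟩
      exact ⟨(e n).inv y, rfl⟩
  · intro n x
    rw [← e3 (n + 1) x]
    exact map_eq_zero_iff (e n).hom.hom (einj n)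
  · intro n x
    refine (e1 (n + 1) ((e n).inv x)).trans ⟨?_, ?_⟩
    · rintro ⟨y, hy⟩
      exact ⟨y, (congrArg (e n).hom hy).trans (inv_hom n x)⟩
    · rintro ⟨y, rfl⟩
      exact ⟨y, (hom_inv n _).symm⟩
  · rw [← ModuleCat.epi_iff_surjective]
    exact (hS.homology_exact₃ 1 0 rfl).epi_f (zero'.eq_of_tgt _ _)
  · rw [← ModuleCat.mono_iff_injective]
    exact (hS.homology_exact₂ 0).mono_g (zero'.eq_of_src _ _)
  · rw [← ModuleCat.epi_iff_surjective]
    exact HomologicalComplex.epi_homologyMap_of_epi_of_not_rel _ _ (by simp)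

/-- The morphism of modules over a group homomorphism given by an equivariant map. -/
def groupModuleHom {Γ Γ' M M' : Type u} [Group Γ] [Group Γ'] [AddCommGroup M] [AddCommGroup M']
    {ρ : Γ →* AddMonoid.End M} {ρ' : Γ' →* AddMonoid.End M'} (f : Γ →* Γ') (φ : M →+ M')
    (h : ∀ g a, φ (ρ g a) = ρ' (f g) (φ a)) :
    groupModule ρ ⟶ Rep.res f (groupModule ρ') :=
  Rep.ofHom
    { toFun := φ
      map_add' := map_add φ
      map_smul' := fun r a => map_zsmul φ r.down a
      isIntertwining' := fun g => by
        ext a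
        exact h g a }

/-! ### The bar bicomplex: functoriality in the coefficients and row differentials. -/

namespace SimplicialAction

open scoped Simplicial

variable {S : SimplicialObject GrpCat.{u}} {M M' M'' : SimplicialObject AddCommGrpCat.{u}}

/-- The morphism of simplicial chain complexes induced by an equivariant morphism. -/
noncomputable def barMap (ρ : SimplicialAction S M) (ρ' : SimplicialAction S M') (φ : M ⟶ M')
    (h : ∀ n g a, φ.app n (ρ.act n g a) = ρ'.act n g (φ.app n a)) :
    ρ.barComplexes ⟶ ρ'.barComplexes where
  app n := groupHomology.chainsMap (MonoidHom.id _)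
    (groupModuleHom (ρ' := ρ'.act n) (MonoidHom.id _) (φ.app n).hom (h n))
  naturality m n f := by
    refine (groupHomology.chainsMap_comp _ _ _ _).symm.trans
      (Eq.trans ?_ (groupHomology.chainsMap_comp _ _ _ _))
    refine groupHomology.chainsMap_congr rfl ?_
    ext a
    exact congr($(φ.naturality f) a)

/-- The morphism of bicomplexes induced by an equivariant morphism. -/
noncomputable def bicomplexMap (ρ : SimplicialAction S M) (ρ' : SimplicialAction S M')
    (φ : M ⟶ M') (h : ∀ n g a, φ.app n (ρ.act n g a) = ρ'.act n g (φ.app n a)) :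
    ρ.bicomplex ⟶ ρ'.bicomplex :=
  (AlgebraicTopology.alternatingFaceMapComplex _).map (barMap ρ ρ' φ h)

/-- This description reduces exactness of the bicomplexes to exactness of the coefficients, one
tuple of group elements at a time. -/
lemma bicomplexMap_f_f (ρ : SimplicialAction S M) (ρ' : SimplicialAction S M')
    (φ : M ⟶ M') (h : ∀ n g a, φ.app n (ρ.act n g a) = ρ'.act n g (φ.app n a)) (p q : ℕ)
    (x : (Fin q → S.obj (.op ⦋p⦌)) →₀ M.obj (.op ⦋p⦌)) :
    ((bicomplexMap ρ ρ' φ h).f p).f q x =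
      Finsupp.mapRange (φ.app (.op ⦋p⦌)) (map_zero (φ.app (.op ⦋p⦌)).hom) x := by
  change ((groupHomology.chainsMap (MonoidHom.id _)
    (groupModuleHom (ρ' := ρ'.act _) (MonoidHom.id _) (φ.app (.op ⦋p⦌)).hom (h _))).f q).hom x = _
  erw [groupHomology.chainsMap_id_f_hom_eq_mapRange]
  rfl

/-- The chain supported on a tuple of simplices, with value a given simplex of the module. -/
noncomputable def single (ρ : SimplicialAction S M) {p q : ℕ} (x : Fin q → S.obj (.op ⦋p⦌))
    (a : M.obj (.op ⦋p⦌)) : (ρ.bicomplex.X p).X q :=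
  (Finsupp.single x a : (Fin q → S.obj (.op ⦋p⦌)) →₀ M.obj (.op ⦋p⦌))

lemma alternatingFaceMapComplex_d_f_apply {R : Type u} [CommRing R]
    (X : SimplicialObject (ChainComplex (ModuleCat.{u} R) ℕ)) (p q : ℕ)
    (b : (X.obj (.op ⦋p + 1⦌)).X q) :
    (((AlgebraicTopology.alternatingFaceMapComplex _).obj X).d (p + 1) p).f q b =
      ∑ i : Fin (p + 2), (-1 : ℤ) ^ (i : ℕ) • (X.δ i).f q b := by
  have : (((AlgebraicTopology.alternatingFaceMapComplex _).obj X).d (p + 1) p).f q =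
      ∑ i : Fin (p + 2), (-1 : ℤ) ^ (i : ℕ) • (X.δ i).f q := by
    rw [AlgebraicTopology.alternatingFaceMapComplex_obj_d]
    exact map_sum (HomologicalComplex.Hom.fAddMonoidHom q) _ _
  have := congr($(this).hom b)
  rw [ModuleCat.hom_sum, LinearMap.sum_apply] at this
  exact this

lemma bicomplex_d_single (ρ : SimplicialAction S M) {p q : ℕ} (x : Fin q → S.obj (.op ⦋p + 1⦌))
    (a : M.obj (.op ⦋p + 1⦌)) :
    (ρ.bicomplex.d (p + 1) p).f q (ρ.single x a) =
      ∑ i : Fin (p + 2), (-1 : ℤ) ^ (i : ℕ) • ρ.single (fun j => S.δ i (x j)) (M.δ i a) := by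
  refine (alternatingFaceMapComplex_d_f_apply ρ.barComplexes p q _).trans ?_
  exact Finset.sum_congr rfl fun i _ =>
    congrArg _ (groupHomology.chainsMap_f_single _ _ _ _ _)

end SimplicialAction

/-! ### Row contractions from extra degeneracies. -/

namespace SimplicialAction

open scoped Simplicial
open HomologicalComplex₂.FirstQuadrant

variable {S : SimplicialObject GrpCat.{u}} {M : SimplicialObject AddCommGrpCat.{u}}

/-- The linear map of finitely supported functions induced by a map of index sets and an additive
map of coefficients. -/
noncomputable def finsuppMap {X Y A B : Type u} [AddCommGroup A] [AddCommGroup B] (t : X → Y)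
    (σ : A →+ B) : (X →₀ A) →ₗ[ULift.{u} ℤ] (Y →₀ B) where
  toFun x := Finsupp.mapRange.addMonoidHom σ (Finsupp.mapDomain.addMonoidHom t x)
  map_add' x y := by rw [map_add, map_add]
  map_smul' r x := by
    have h : r • x = r.down • x := rfl
    rw [h, map_zsmul, map_zsmul]
    rfl

lemma finsuppMap_single {X Y A B : Type u} [AddCommGroup A] [AddCommGroup B] (t : X → Y)
    (σ : A →+ B) (x : X) (a : A) :
    finsuppMap t σ (Finsupp.single x a) = Finsupp.single (t x) (σ a) := by
  simp [finsuppMap]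

/-- The map between entries of a row of the bicomplex induced by a map of simplices of the
simplicial group and an additive map of simplices of the simplicial module. -/
noncomputable def rowMap (ρ : SimplicialAction S M) (p p' q : ℕ)
    (t : S.obj (.op ⦋p⦌) → S.obj (.op ⦋p'⦌)) (σ : M.obj (.op ⦋p⦌) →+ M.obj (.op ⦋p'⦌)) :
    (ρ.bicomplex.X p).X q ⟶ (ρ.bicomplex.X p').X q :=
  ModuleCat.ofHom (finsuppMap (t ∘ ·) σ)

lemma rowMap_single (ρ : SimplicialAction S M) (p p' q : ℕ)
    (t : S.obj (.op ⦋p⦌) → S.obj (.op ⦋p'⦌)) (σ : M.obj (.op ⦋p⦌) →+ M.obj (.op ⦋p'⦌))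
    (x : Fin q → S.obj (.op ⦋p⦌)) (a : M.obj (.op ⦋p⦌)) :
    ρ.rowMap p p' q t σ (ρ.single x a) = ρ.single (fun j => t (x j)) (σ a) :=
  finsuppMap_single _ _ _ _

lemma bicomplex_induction (ρ : SimplicialAction S M) {p q : ℕ}
    {P : (ρ.bicomplex.X p).X q → Prop} (zero : P 0) (add : ∀ x y, P x → P y → P (x + y))
    (single : ∀ x a, P (ρ.single x a)) (x) : P x :=
  Finsupp.induction_linear (M := M.obj (.op ⦋p⦌)) (motive := P) x zero add single

/-- A contraction of a simplicial group and a simplicial module, as sets and as abelian groups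
respectively, gives a contraction of the rows of the bicomplex. -/
noncomputable def rowContraction (ρ : SimplicialAction S M)
    {E : ChainComplex (ModuleCat.{u} (ULift.{u} ℤ)) ℕ} (ε : ρ.bicomplex.X 0 ⟶ E)
    (d_ε : ρ.bicomplex.d 1 0 ≫ ε = 0) (η : ∀ q, E.X q ⟶ (ρ.bicomplex.X 0).X q)
    (η_ε : ∀ q e, ε.f q (η q e) = e)
    (t : ∀ p, S.obj (.op ⦋p⦌) → S.obj (.op ⦋p + 1⦌))
    (σ : ∀ p, M.obj (.op ⦋p⦌) →+ M.obj (.op ⦋p + 1⦌))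
    (t_zero : ∀ p x, S.δ 0 (t p x) = x) (σ_zero : ∀ p x, M.δ 0 (σ p x) = x)
    (t_succ : ∀ p (i : Fin (p + 2)) x, S.δ i.succ (t (p + 1) x) = t p (S.δ i x))
    (σ_succ : ∀ p (i : Fin (p + 2)) x, M.δ i.succ (σ (p + 1) x) = σ p (M.δ i x))
    (h_one : ∀ q (x : Fin q → S.obj (.op ⦋0⦌)) a,
      ρ.single (fun j => S.δ 1 (t 0 (x j))) (M.δ 1 (σ 0 a)) = η q (ε.f q (ρ.single x a))) :
    RowContraction ρ.bicomplex E where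
  ε := ε
  d_ε := d_ε
  η := η
  -- The row differentials use only tuples and coefficients, so `t` need not be multiplicative and
  -- no equivariance is required.
  h p q := ρ.rowMap p (p + 1) q (t p) (σ p)
  η_ε := η_ε
  d_h_zero q b := by
    induction b using ρ.bicomplex_induction with
    | zero => simp only [map_zero, sub_zero]
    | add x y hx hy => simp only [map_add, hx, hy]; abel
    | single x a =>
      rw [rowMap_single, bicomplex_d_single, Fin.sum_univ_two, ← h_one]
      simp only [t_zero, σ_zero, Fin.val_zero, Fin.val_one, pow_zero, pow_one, one_smul, neg_smul,
        sub_eq_add_neg]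
  d_h_succ p q b := by
    induction b using ρ.bicomplex_induction with
    | zero => simp only [map_zero, sub_zero]
    | add x y hx hy => simp only [map_add, hx, hy]; abel
    | single x a =>
      -- Face 0 returns the original chain. The other faces commute with the extra degeneracy up to
      -- an index shift, which supplies the minus sign.
      rw [rowMap_single, bicomplex_d_single, Fin.sum_univ_succ, bicomplex_d_single, map_sum,
        sub_eq_add_neg, ← Finset.sum_neg_distrib]
      simp only [t_zero, σ_zero, t_succ, σ_succ, map_zsmul, rowMap_single, Fin.val_zero, pow_zero,
        one_smul, Fin.val_succ, pow_succ, mul_neg, mul_one, neg_smul]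

/-- The action on a constant simplicial module of a simplicial group over a group. -/
def const {Γ B : Type u} [Group Γ] [AddCommGroup B] (ρ : Γ →* AddMonoid.End B)
    (π : ∀ n, S.obj n →* Γ) (nat : ∀ {m n} (f : m ⟶ n) x, π n (S.map f x) = π m x) :
    SimplicialAction S ((Functor.const _).obj (AddCommGrpCat.of B)) where
  act n := ρ.comp (π n)
  map_act f g a := by
    change ρ (π _ g) a = ρ (π _ (S.map f g)) a
    rw [nat]

section const

variable {Γ B : Type u} [Group Γ] [AddCommGroup B] (ρ : Γ →* AddMonoid.End B)
    (π : ∀ n, S.obj n →* Γ) (nat : ∀ {m n} (f : m ⟶ n) x, π n (S.map f x) = π m x)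

/-- The augmentation of the bicomplex of a constant simplicial module. -/
noncomputable def constε :
    (const ρ π nat).bicomplex.X 0 ⟶ groupHomology.inhomogeneousChains (groupModule ρ) :=
  groupHomology.chainsMap (π (.op ⦋0⦌))
    (groupModuleHom (ρ' := ρ) (π (.op ⦋0⦌)) (AddMonoidHom.id B) fun _ _ => rfl)

lemma constε_single (q : ℕ) (x : Fin q → S.obj (.op ⦋0⦌)) (a : B) :
    (constε ρ π nat).f q ((const ρ π nat).single x a) =
      Finsupp.single (fun j => π _ (x j)) a :=
  groupHomology.chainsMap_f_single _ _ _ _ _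

/-- A contraction of a simplicial group onto a group gives a contraction of the rows of the
bicomplex of a constant simplicial module. -/
noncomputable def constRowContraction (s : Γ → S.obj (.op ⦋0⦌)) (π_s : ∀ g, π _ (s g) = g)
    (t : ∀ p, S.obj (.op ⦋p⦌) → S.obj (.op ⦋p + 1⦌))
    (t_zero : ∀ p x, S.δ 0 (t p x) = x)
    (t_succ : ∀ p (i : Fin (p + 2)) x, S.δ i.succ (t (p + 1) x) = t p (S.δ i x))
    (t_one : ∀ x, S.δ 1 (t 0 x) = s (π _ x)) :
    RowContraction (const ρ π nat).bicomplex
      (groupHomology.inhomogeneousChains (groupModule ρ)) :=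
  (const ρ π nat).rowContraction (constε ρ π nat)
    (by
      refine HomologicalComplex.hom_ext _ _ fun q => ModuleCat.hom_ext (LinearMap.ext fun b => ?_)
      change (constε ρ π nat).f q (((const ρ π nat).bicomplex.d 1 0).f q b) = 0
      induction b using (const ρ π nat).bicomplex_induction with
      | zero => simp only [map_zero]
      | add x y hx hy => simp only [map_add, hx, hy, add_zero]
      | single x a =>
        -- Both faces of a 1-simplex lie over the same element of `Γ`, so their difference dies
        -- under the augmentation.
        obtain ⟨z, hz⟩ : ∃ z, ∀ i : Fin 2, (constε ρ π nat).f q ((const ρ π nat).single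
            (fun j => S.δ i (x j)) (SimplicialObject.δ
              ((Functor.const SimplexCategoryᵒᵖ).obj (AddCommGrpCat.of B)) i a)) = z :=
          ⟨Finsupp.single (fun j => π _ (x j)) a, fun i => by
            rw [constε_single]
            refine congrArg₂ Finsupp.single ?_ rfl
            ext j
            exact nat _ _⟩
        rw [bicomplex_d_single, Fin.sum_univ_two, map_add, map_zsmul, map_zsmul, hz, hz]
        simp)
    (fun q => ModuleCat.ofHom (finsuppMap (s ∘ ·) (AddMonoidHom.id B)))
    (fun q e => by
      let F := (ModuleCat.ofHom (finsuppMap (s ∘ ·) (AddMonoidHom.id B)) ≫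
        (constε ρ π nat).f q).hom
      refine Finsupp.induction_linear (M := B) (motive := fun e => F e = e) e ?_ ?_ ?_
      · exact F.map_zero
      · exact fun x y hx hy => (F.map_add x y).trans (congrArg₂ (· + ·) hx hy)
      · intro x a
        refine (congrArg ((constε ρ π nat).f q) (finsuppMap_single _ _ _ _)).trans ?_
        refine (constε_single ρ π nat q _ _).trans ?_
        simp only [Function.comp_apply, π_s]
        rfl)
    t (fun _ => AddMonoidHom.id B) t_zero (fun _ _ => rfl) t_succ (fun _ _ _ => rfl)
    (fun q x a => by
      rw [constε_single]
      refine Eq.trans ?_ (finsuppMap_single _ _ _ _).symm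
      simp only [t_one]
      rfl)

end const

end SimplicialAction

/-! ### Contractions of the two nerves. -/

namespace CrossedModule

open scoped Simplicial

section nerve

variable {G : Type u} [Group G] (N : Subgroup G) [N.Normal]

/-- A simplex of the nerve of an inclusion crossed module is determined by its objects. -/
lemma nerveObj_inclusion_ext {N : Subgroup G} [N.Normal] {n : ℕ}
    {x y : NerveObj (inclusion N) n} (h : ∀ i, x.obj i = y.obj i) : x = y := by
  refine NerveObj.ext (funext h) (funext fun i => funext fun j => funext fun hij => ?_)
  have hx := x.obj_eq i j hij
  rw [h, h, y.obj_eq i j hij] at hx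
  exact (Subtype.ext (mul_right_cancel hx)).symm

/-- The simplex of the nerve of an inclusion crossed module given by a family of objects in the
same coset. -/
def nerveObjOfObj {n : ℕ} (x : Fin (n + 1) → G) (h : ∀ i j, x i * (x j)⁻¹ ∈ N) :
    NerveObj (inclusion N) n where
  obj := x
  hom i j _ := ⟨x i * (x j)⁻¹, h i j⟩
  hom_comp i j k _ _ := Subtype.ext (by simp)
  obj_eq i j _ := by simp [inclusion]

lemma mk_obj_eq {N : Subgroup G} [N.Normal] {n : ℕ} (x : NerveObj (inclusion N) n)
    (i j : Fin (n + 1)) : (x.obj i : G ⧸ N) = x.obj j := by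
  have key : ∀ i j, i ≤ j → (x.obj i : G ⧸ N) = x.obj j := fun i j hij => by
    have h : ((inclusion N).μ (x.hom i j hij) : G ⧸ N) = 1 :=
      (QuotientGroup.eq_one_iff _).2 (x.hom i j hij).2
    rw [x.obj_eq i j hij, QuotientGroup.mk_mul, h, one_mul]
  rcases le_total i j with h | h
  · exact key i j h
  · exact (key j i h).symm

/-- The augmentation of the nerve of an inclusion crossed module to the quotient group. -/
def nerveToQuotient (n : SimplexCategoryᵒᵖ) : (inclusion N).nerve.obj n →* G ⧸ N where
  toFun := fun x : NerveObj (inclusion N) n.unop.len => (x.obj 0 : G ⧸ N)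
  map_one' := rfl
  map_mul' _ _ := rfl

lemma nerveToQuotient_map {m n : SimplexCategoryᵒᵖ} (f : m ⟶ n)
    (x : (inclusion N).nerve.obj m) :
    nerveToQuotient N n ((inclusion N).nerve.map f x) = nerveToQuotient N m x :=
  mk_obj_eq (N := N) x _ _

/-- The set-theoretic section of the augmentation of the nerve. -/
noncomputable def nerveSection (g : G ⧸ N) : (inclusion N).nerve.obj (.op ⦋0⦌) :=
  nerveObjOfObj N (n := 0) (fun _ => g.out) (by simp)

/-- The extra degeneracies of the nerve of an inclusion crossed module. -/
noncomputable def nerveExtra (p : ℕ) (x : (inclusion N).nerve.obj (.op ⦋p⦌)) :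
    (inclusion N).nerve.obj (.op ⦋p + 1⦌) :=
  nerveObjOfObj N (n := p + 1)
    (Fin.cons (nerveToQuotient N (.op ⦋p⦌) x).out (NerveObj.obj x)) fun i j => by
      rw [← QuotientGroup.eq_one_iff, QuotientGroup.mk_mul, QuotientGroup.mk_inv, mul_inv_eq_one]
      have key : ∀ i, ((Fin.cons (nerveToQuotient N (.op ⦋p⦌) x).out (NerveObj.obj x) :
          Fin (p + 2) → G) i : G ⧸ N) = nerveToQuotient N (.op ⦋p⦌) x := by
        refine Fin.cases ?_ fun i => ?_
        · exact Quotient.out_eq _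
        · exact mk_obj_eq (N := N) x _ _
      rw [key, key]

lemma nerveExtra_zero (p : ℕ) (x : (inclusion N).nerve.obj (.op ⦋p⦌)) :
    (inclusion N).nerve.δ 0 (nerveExtra N p x) = x :=
  nerveObj_inclusion_ext fun _ => rfl

lemma nerveExtra_succ (p : ℕ) (i : Fin (p + 2)) (x : (inclusion N).nerve.obj (.op ⦋p + 1⦌)) :
    (inclusion N).nerve.δ i.succ (nerveExtra N (p + 1) x) =
      nerveExtra N p ((inclusion N).nerve.δ i x) := by
  refine nerveObj_inclusion_ext (Fin.cases ?_ fun j => ?_)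
  -- The prepended representative depends only on the coset, which faces preserve.
  · exact congrArg Quotient.out (nerveToQuotient_map N _ x).symm
  · change Fin.cons (α := fun _ => G) _ (NerveObj.obj x) (i.succ.succAbove j.succ) = _
    rw [Fin.succ_succAbove_succ]
    rfl

lemma nerveExtra_one (x : (inclusion N).nerve.obj (.op ⦋0⦌)) :
    (inclusion N).nerve.δ 1 (nerveExtra N 0 x) =
      nerveSection N (nerveToQuotient N (.op ⦋0⦌) x) := by
  refine nerveObj_inclusion_ext fun i => ?_
  obtain rfl : i = 0 := Subsingleton.elim (α := Fin 1) _ _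
  rfl

end nerve

section abNerve

variable {C : Type u} [AddCommGroup C]

lemma abNerveObj_id_ext {n : ℕ} {x y : AbNerveObj (AddMonoidHom.id C) n}
    (h : ∀ i, x.obj i = y.obj i) : x = y := by
  refine AbNerveObj.ext (funext h) (funext fun i => funext fun j => funext fun hij => ?_)
  have hx := x.obj_eq i j hij
  rw [h, h, y.obj_eq i j hij] at hx
  exact (add_right_cancel hx).symm

/-- The simplex of the nerve of an identity map given by a family of objects. -/
def abNerveObjOfObj {n : ℕ} (x : Fin (n + 1) → C) : AbNerveObj (AddMonoidHom.id C) n where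
  obj := x
  hom i j _ := x i - x j
  hom_comp i j k _ _ := by abel
  obj_eq i j _ := by simp

/-- The extra degeneracies of the nerve of an identity map. -/
def abNerveExtra (p : ℕ) : (abNerve (AddMonoidHom.id C)).obj (.op ⦋p⦌) →+
    (abNerve (AddMonoidHom.id C)).obj (.op ⦋p + 1⦌) where
  toFun x := abNerveObjOfObj (n := p + 1) (Fin.cons 0 (AbNerveObj.obj x))
  map_zero' := abNerveObj_id_ext (Fin.cases rfl fun _ => rfl)
  map_add' _ _ := abNerveObj_id_ext (Fin.cases (add_zero (0 : C)).symm fun _ => rfl)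

lemma abNerveExtra_zero (p : ℕ) (x : (abNerve (AddMonoidHom.id C)).obj (.op ⦋p⦌)) :
    (abNerve (AddMonoidHom.id C)).δ 0 (abNerveExtra p x) = x :=
  abNerveObj_id_ext fun _ => rfl

lemma abNerveExtra_succ (p : ℕ) (i : Fin (p + 2))
    (x : (abNerve (AddMonoidHom.id C)).obj (.op ⦋p + 1⦌)) :
    (abNerve (AddMonoidHom.id C)).δ i.succ (abNerveExtra (p + 1) x) =
      abNerveExtra p ((abNerve (AddMonoidHom.id C)).δ i x) := by
  refine abNerveObj_id_ext (Fin.cases ?_ fun j => ?_)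
  · rfl
  · change Fin.cons (α := fun _ => C) _ (AbNerveObj.obj x) (i.succ.succAbove j.succ) = _
    rw [Fin.succ_succAbove_succ]
    rfl

/-- Only the prepended `0` survives this face, so the contraction is onto the zero complex. -/
lemma abNerveExtra_one (x : (abNerve (AddMonoidHom.id C)).obj (.op ⦋0⦌)) :
    (abNerve (AddMonoidHom.id C)).δ 1 (abNerveExtra 0 x) = 0 := by
  refine abNerveObj_id_ext fun i => ?_
  obtain rfl : i = 0 := Subsingleton.elim (α := Fin 1) _ _
  rfl

end abNerve

/-! ### The four term exact sequence of simplicial modules. -/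

namespace Action

variable {G : Type u} [Group G] {N : Subgroup G} [N.Normal]
variable {C A : Type u} [AddCommGroup C] [AddCommGroup A] {ν : C →+ A}

/-- The action on the identity of `C` induced by an action on `ν : C →+ A`. -/
def onId {H : Type u} [Group H] {X : CrossedModule H G} (α : X.Action ν) :
    X.Action (AddMonoidHom.id C) where
  actC := α.actC
  actA := α.actC
  -- This choice is forced: for the identity of `C`, `ν_ξ` demands the value `ʰc - c`.
  ξ h c := α.ξ h (ν c)
  ν_act _ _ := rfl
  ν_ξ h c := α.ξ_ν h c
  ξ_ν h c := α.ξ_ν h c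
  act_ξ g h c := by rw [α.act_ξ, α.ν_act]
  ξ_mul h h' c := α.ξ_mul h h' (ν c)
  ξ_add h c c' := by rw [map_add, α.ξ_add]

variable (α : (inclusion N).Action ν)

/-- The constant simplicial module `Ker ν`. -/
def kerAction : SimplicialAction (inclusion N).nerve
    ((Functor.const _).obj (AddCommGrpCat.of ν.ker)) :=
  .const α.quotientActKer (nerveToQuotient N) (nerveToQuotient_map N)

/-- The constant simplicial module `A / Im ν`. -/
def cokerAction : SimplicialAction (inclusion N).nerve
    ((Functor.const _).obj (AddCommGrpCat.of (A ⧸ ν.range))) :=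
  .const α.quotientActCoker (nerveToQuotient N) (nerveToQuotient_map N)

variable (ν)

/-- The inclusion of `Ker ν` in the nerve of the identity of `C`. -/
def kerToNerve : (Functor.const _).obj (AddCommGrpCat.of ν.ker) ⟶
    abNerve (AddMonoidHom.id C) where
  app n := AddCommGrpCat.ofHom
    { toFun := fun k => (abNerveObjOfObj fun _ => (k : C) : AbNerveObj _ n.unop.len)
      map_zero' := abNerveObj_id_ext fun _ => rfl
      map_add' := fun _ _ => abNerveObj_id_ext fun _ => rfl }
  naturality _ _ _ := rfl

/-- The morphism from the nerve of the identity of `C` to that of `ν`. -/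
def nerveToNerve : abNerve (AddMonoidHom.id C) ⟶ abNerve ν where
  app n := AddCommGrpCat.ofHom
    { toFun := fun y =>
        ({ obj := fun i => ν (y.obj i)
           hom := y.hom
           hom_comp := y.hom_comp
           obj_eq := fun i j hij => by
             conv_lhs => rw [y.obj_eq i j hij]
             exact map_add ν _ _ } : AbNerveObj ν n.unop.len)
      map_zero' := AbNerveObj.ext (funext fun _ => map_zero ν) rfl
      map_add' := fun _ _ => AbNerveObj.ext (funext fun _ => map_add ν _ _) rfl }
  naturality _ _ _ := rfl

/-- The morphism from the nerve of `ν` to `A / Im ν`. -/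
def nerveToCoker : abNerve ν ⟶ (Functor.const _).obj (AddCommGrpCat.of (A ⧸ ν.range)) where
  app n := AddCommGrpCat.ofHom
    { toFun := fun y : AbNerveObj ν n.unop.len => (y.obj 0 : A ⧸ ν.range)
      map_zero' := rfl
      map_add' := fun _ _ => rfl }
  naturality m n f := by
    ext y
    refine QuotientAddGroup.eq_iff_sub_mem.2 ?_
    -- Two vertices of a simplex differ by `ν` of the arrow joining them.
    refine ⟨-AbNerveObj.hom y 0 (f.unop.toOrderHom 0) (Fin.zero_le _), ?_⟩
    have := AbNerveObj.obj_eq y 0 (f.unop.toOrderHom 0) (Fin.zero_le _)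
    change _ = AbNerveObj.obj y (f.unop.toOrderHom 0) - AbNerveObj.obj y 0
    rw [this, map_neg]
    abel

variable {ν}

lemma kerToNerve_injective (n) : Function.Injective ((kerToNerve ν).app n) := fun _ _ h =>
  Subtype.ext congr(AbNerveObj.obj $h 0)

lemma kerToNerve_exact (n) :
    Function.Exact ((kerToNerve ν).app n) ((nerveToNerve ν).app n) := by
  intro y
  constructor
  · intro h
    have hobj : ∀ i, ν (AbNerveObj.obj y i) = 0 := fun i => congr(AbNerveObj.obj $h i)
    refine ⟨⟨AbNerveObj.obj y 0, hobj 0⟩, abNerveObj_id_ext fun i => ?_⟩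
    -- The map leaves arrows unchanged, so in its kernel all arrows vanish and all vertices agree.
    have h0 : AbNerveObj.hom y 0 i (Fin.zero_le _) = 0 :=
      congr(AbNerveObj.hom $h 0 i (Fin.zero_le _))
    refine (AbNerveObj.obj_eq y 0 i (Fin.zero_le _)).trans ?_
    rw [h0]
    exact zero_add _
  · rintro ⟨k, rfl⟩
    refine AbNerveObj.ext (funext fun i => k.2) ?_
    funext i j hij
    exact sub_self (Subtype.val (p := (· ∈ ν.ker)) k)

lemma nerveToNerve_exact (n) :
    Function.Exact ((nerveToNerve ν).app n) ((nerveToCoker ν).app n) := by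
  intro y
  constructor
  · intro h
    obtain ⟨c, hc⟩ : AbNerveObj.obj y 0 ∈ ν.range := (QuotientAddGroup.eq_zero_iff _).1 h
    -- A lift `c` of vertex 0 determines the rest, because the arrows must be those of `y`.
    refine ⟨(abNerveObjOfObj fun i => c - AbNerveObj.hom y 0 i (Fin.zero_le _) :
      AbNerveObj _ n.unop.len), AbNerveObj.ext (funext fun i => ?_) ?_⟩
    · change ν (c - _) = _
      rw [map_sub, hc, AbNerveObj.obj_eq y 0 i (Fin.zero_le _)]
      abel
    · funext i j hij
      change (c - _) - (c - _) = _
      rw [← AbNerveObj.hom_comp y 0 i j (Fin.zero_le _) hij]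
      abel
  · rintro ⟨z, rfl⟩
    exact (QuotientAddGroup.eq_zero_iff _).2 ⟨AbNerveObj.obj z 0, rfl⟩

lemma nerveToCoker_surjective (n) : Function.Surjective ((nerveToCoker ν).app n) := by
  intro z
  obtain ⟨a, rfl⟩ := QuotientAddGroup.mk_surjective z
  exact ⟨({ obj := fun _ => a, hom := fun _ _ _ => 0, hom_comp := fun _ _ _ _ _ => zero_add _,
            obj_eq := fun _ _ _ => by simp } : AbNerveObj ν n.unop.len), rfl⟩

lemma kerToNerve_equivariant (n g a) : (kerToNerve ν).app n (α.kerAction.act n g a) =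
    α.onId.simplicialAction.act n g ((kerToNerve ν).app n a) := by
  refine abNerveObj_id_ext fun i => ?_
  change ((α.quotientActKer ((show NerveObj (inclusion N) n.unop.len from g).obj 0) a : ν.ker) : C) = _
  -- The constant module is acted on through vertex 0, the `i`th vertex of the nerve through vertex
  -- `i`; the two lie in the same coset.
  rw [mk_obj_eq (N := N) g 0 i]
  rfl

lemma nerveToNerve_equivariant (n g a) :
    (nerveToNerve ν).app n (α.onId.simplicialAction.act n g a) =
      α.simplicialAction.act n g ((nerveToNerve ν).app n a) := by
  refine AbNerveObj.ext (funext fun i => α.ν_act _ _) ?_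
  funext i j hij
  refine congrArg (_ + α.ξ _ ·) (α.ν_act _ _)

lemma nerveToCoker_equivariant (n g a) :
    (nerveToCoker ν).app n (α.simplicialAction.act n g a) =
      α.cokerAction.act n g ((nerveToCoker ν).app n a) := rfl

end Action
end CrossedModule

/-! ### Contractions of the three auxiliary bicomplexes. -/

namespace CrossedModule.Action

open scoped Simplicial ZeroObject
open HomologicalComplex₂.FirstQuadrant

variable {G : Type u} [Group G] {N : Subgroup G} [N.Normal]
variable {C A : Type u} [AddCommGroup C] [AddCommGroup A] {ν : C →+ A}
variable (α : (inclusion N).Action ν)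

/-- The rows of the bicomplex of the identity of `C` are contractible. -/
noncomputable def onIdRowContraction : RowContraction α.onId.simplicialAction.bicomplex 0 :=
  α.onId.simplicialAction.rowContraction 0 Limits.comp_zero (fun _ => 0)
    (fun q e => (ModuleCat.subsingleton_of_isZero
      ((HomologicalComplex.eval _ _ q).map_isZero (Limits.isZero_zero _))).elim _ _)
    (nerveExtra N) abNerveExtra (nerveExtra_zero N) abNerveExtra_zero (nerveExtra_succ N)
    abNerveExtra_succ (fun q x a => by
      rw [abNerveExtra_one]
      exact Finsupp.single_zero _)

/-- The contraction of the rows of the bicomplex of `Ker ν`. -/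
noncomputable def kerRowContraction : RowContraction α.kerAction.bicomplex
    (groupHomology.inhomogeneousChains (groupModule α.quotientActKer)) :=
  SimplicialAction.constRowContraction _ _ _ (nerveSection N) (fun g => Quotient.out_eq g)
    (nerveExtra N) (nerveExtra_zero N) (nerveExtra_succ N) (nerveExtra_one N)

/-- The contraction of the rows of the bicomplex of `A / Im ν`. -/
noncomputable def cokerRowContraction : RowContraction α.cokerAction.bicomplex
    (groupHomology.inhomogeneousChains (groupModule α.quotientActCoker)) :=
  SimplicialAction.constRowContraction _ _ _ (nerveSection N) (fun g => Quotient.out_eq g)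
    (nerveExtra N) (nerveExtra_zero N) (nerveExtra_succ N) (nerveExtra_one N)

lemma onId_acyclic : (tot α.onId.simplicialAction.bicomplex).Acyclic := by
  intro n
  have := α.onIdRowContraction.quasiIso_totMap
  exact (HomologicalComplex.exactAt_iff_isZero_homology _ _).2
    (((HomologicalComplex.homologyFunctor _ _ n).map_isZero (Limits.isZero_zero _)).of_iso
      (isoOfQuasiIsoAt α.onIdRowContraction.totMap n))

end CrossedModule.Action

/-! ### Exactness of the total complexes in the coefficients. -/

namespace SimplicialAction

variable {S : SimplicialObject GrpCat.{u}} {M M' M'' : SimplicialObject AddCommGrpCat.{u}}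
  (ρ : SimplicialAction S M) (ρ' : SimplicialAction S M') (ρ'' : SimplicialAction S M'')
  (φ : M ⟶ M') (h : ∀ n g a, φ.app n (ρ.act n g a) = ρ'.act n g (φ.app n a))
  (ψ : M' ⟶ M'') (h' : ∀ n g a, ψ.app n (ρ'.act n g a) = ρ''.act n g (ψ.app n a))

open HomologicalComplex₂.FirstQuadrant

lemma totMap_bicomplexMap_injective (hφ : ∀ n, Function.Injective (φ.app n)) (n : ℕ) :
    Function.Injective ((totMap (bicomplexMap ρ ρ' φ h)).f n) := by
  refine totMap_injective _ (fun p q x y hxy => ?_) n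
  exact Finsupp.mapRange_injective _ (map_zero (φ.app _).hom) (hφ _)
    (((bicomplexMap_f_f ρ ρ' φ h p q x).symm.trans hxy).trans (bicomplexMap_f_f ρ ρ' φ h p q y))

lemma totMap_bicomplexMap_surjective (hφ : ∀ n, Function.Surjective (φ.app n)) (n : ℕ) :
    Function.Surjective ((totMap (bicomplexMap ρ ρ' φ h)).f n) := by
  refine totMap_surjective _ (fun p q y => ?_) n
  obtain ⟨x, hx⟩ := Finsupp.mapRange_surjective _ (map_zero (φ.app _).hom) (hφ _) y
  exact ⟨x, (bicomplexMap_f_f ρ ρ' φ h p q x).trans hx⟩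

lemma totMap_bicomplexMap_exact (hφψ : ∀ n, Function.Exact (φ.app n) (ψ.app n)) (n : ℕ) :
    Function.Exact ((totMap (bicomplexMap ρ ρ' φ h)).f n)
      ((totMap (bicomplexMap ρ' ρ'' ψ h')).f n) := by
  refine totMap_exact _ _ (fun p q y => ?_) n
  constructor
  · intro hy
    have hy' := (bicomplexMap_f_f ρ' ρ'' ψ h' p q y).symm.trans hy
    obtain ⟨x, hx⟩ : (show (Fin q → S.obj (.op (.mk p))) →₀ M'.obj (.op (.mk p)) from y) ∈
        Set.range (Finsupp.mapRange (φ.app (.op (.mk p)))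
          (map_zero (φ.app (.op (.mk p))).hom)) := by
      rw [Finsupp.range_mapRange]
      exact fun z => (hφψ _ _).1 (DFunLike.congr_fun
        (F := (Fin q → S.obj (.op (.mk p))) →₀ M''.obj (.op (.mk p))) hy' z)
    exact ⟨x, (bicomplexMap_f_f ρ ρ' φ h p q x).trans hx⟩
  · rintro ⟨x, rfl⟩
    refine (congrArg _ (bicomplexMap_f_f ρ ρ' φ h p q x)).trans
      ((bicomplexMap_f_f ρ' ρ'' ψ h' p q _).trans ?_)
    exact Finsupp.ext fun z => (hφψ _).apply_apply_eq_zero _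

end SimplicialAction

/-! ### The long exact sequence. -/

theorem proposition3 {G : Type u} [Group G] (N : Subgroup G) [N.Normal]
    {C A : Type u} [AddCommGroup C] [AddCommGroup A] (ν : C →+ A)
    (α : (CrossedModule.inclusion N).Action ν) :
    ∃ (i : ∀ n : ℕ, groupHomology (groupModule α.quotientActKer) n →+ α.homology (n + 1))
      (p : ∀ n : ℕ, α.homology n →+ groupHomology (groupModule α.quotientActCoker) n)
      (d : ∀ n : ℕ, groupHomology (groupModule α.quotientActCoker) (n + 2) →+
        groupHomology (groupModule α.quotientActKer) n),
      (∀ n : ℕ, Function.Exact (i n) (p (n + 1))) ∧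
      (∀ n : ℕ, Function.Exact (p (n + 2)) (d n)) ∧
      (∀ n : ℕ, Function.Exact (d n) (i n)) ∧
      Function.Surjective (p 1) ∧
      Function.Bijective (p 0) := by
  obtain ⟨i, d, hip, hpd, hdi, h1, h0⟩ := ChainComplex.exists_long_exact_of_acyclic _ _ _
    (SimplicialAction.totMap_bicomplexMap_injective α.kerAction α.onId.simplicialAction _
      α.kerToNerve_equivariant CrossedModule.Action.kerToNerve_injective)
    (SimplicialAction.totMap_bicomplexMap_exact α.kerAction α.onId.simplicialAction
      α.simplicialAction _ α.kerToNerve_equivariant _ α.nerveToNerve_equivariant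
      CrossedModule.Action.kerToNerve_exact)
    (SimplicialAction.totMap_bicomplexMap_exact α.onId.simplicialAction α.simplicialAction
      α.cokerAction _ α.nerveToNerve_equivariant _ α.nerveToCoker_equivariant
      CrossedModule.Action.nerveToNerve_exact)
    (SimplicialAction.totMap_bicomplexMap_surjective α.simplicialAction α.cokerAction _
      α.nerveToCoker_equivariant CrossedModule.Action.nerveToCoker_surjective)
    α.onId_acyclic
  have := α.kerRowContraction.quasiIso_totMap
  have := α.cokerRowContraction.quasiIso_totMap
  let P := fun n => (HomologicalComplex.homologyMap
    (HomologicalComplex₂.FirstQuadrant.totMap (SimplicialAction.bicomplexMap α.simplicialAction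
      α.cokerAction _ α.nerveToCoker_equivariant)) n).hom.toAddMonoidHom
  -- The row contractions identify the homology of the two outer total complexes with that of `G /
  -- N`; the rest transports exactness along these isomorphisms.
  let eK := fun n => (isoOfQuasiIsoAt α.kerRowContraction.totMap n).toLinearEquiv.toAddEquiv
  let eQ := fun n => (isoOfQuasiIsoAt α.cokerRowContraction.totMap n).toLinearEquiv.toAddEquiv
  refine ⟨fun n => (i n).hom.toAddMonoidHom.comp (eK n).symm.toAddMonoidHom,
    fun n => (eQ n).toAddMonoidHom.comp (P n),
    fun n => (eK n).toAddMonoidHom.comp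
      ((d n).hom.toAddMonoidHom.comp (eQ (n + 2)).symm.toAddMonoidHom), ?_, ?_, ?_, ?_, ?_⟩
  · intro n x
    refine ((eQ (n + 1)).map_eq_zero_iff.trans (hip n x)).trans ⟨?_, ?_⟩
    · rintro ⟨y, rfl⟩
      exact ⟨eK n y, congrArg (i n) ((eK n).symm_apply_apply y)⟩
    · rintro ⟨y, rfl⟩
      exact ⟨(eK n).symm y, rfl⟩
  · intro n x
    refine ((eK n).map_eq_zero_iff.trans (hpd n _)).trans ⟨?_, ?_⟩
    · rintro ⟨y, hy⟩
      exact ⟨y, (congrArg (eQ (n + 2)) hy).trans ((eQ (n + 2)).apply_symm_apply x)⟩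
    · rintro ⟨y, rfl⟩
      exact ⟨y, ((eQ (n + 2)).symm_apply_apply _).symm⟩
  · intro n x
    refine (hdi n _).trans ⟨?_, ?_⟩
    · rintro ⟨y, hy⟩
      refine ⟨eQ (n + 2) y, ?_⟩
      refine (congrArg (fun z => eK n (d n z)) ((eQ (n + 2)).symm_apply_apply y)).trans ?_
      exact (congrArg (eK n) hy).trans ((eK n).apply_symm_apply x)
    · rintro ⟨y, rfl⟩
      exact ⟨(eQ (n + 2)).symm y, ((eK n).symm_apply_apply _).symm⟩
  · exact (eQ 1).surjective.comp h1
  · exact (eQ 0).bijective.comp h0
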